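/- Let $\mathsf{L}_\omega$ be the language of higher-order arithmetic over all finite types ($0$ is the type of natural numbers, $\sigma\to\tau$ the type of maps from type $\sigma$ to type $\tau$; $1:=0\to 0$), with constants $0,1,+,\times$, combinators $\Pi,\Sigma$ and recursors $\mathbf{R}_\sigma$, with $=$ and $<$ between numbers as primitive predicates, and with equality at higher types defined as equality of all values. Let $\mathsf{RCA}_0^\omega$ be the theory in classical logic with equality for numbers given by: the basic axioms of a (discretely) ordered semi-ring, the defining axioms of $\Pi$ and $\Sigma$, the defining axiom of the recursor $\mathbf{R}_0$, i.e. $\mathbf{R}_0(f,m,0)=m$ and $\mathbf{R}_0(f,m,n+1)=f(n,\mathbf{R}_0(f,m,n))$, the axiom of extensionality for all finite types, induction for quantifier-free formulas, and $\mathsf{QF\text{-}AC}^{1,0}$, i.e. $(\forall x^1)(\exists y^0)A(x,y)\to(\exists Y^{1\to 0})(\forall x^1)A(x,Y(x))$ for quantifier-free $A$. Let $\mathsf{IND}$ be the induction axiom for all formulas of $\mathsf{L}_\omega$. In $\mathsf{L}_\omega$, a real is a sequence of rationals $(q_n)_{n\in\mathbb N}$, coded as a type $1$ object, with $|q_n-q_{n+i}|<2^{-n}$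 for all $n,i$; reals $(q_n)$ and $(r_n)$ are equal if $|q_n-r_n|\le 2^{-n+1}$ for all $n$; and functions $a:[0,1]\to\mathbb R$ and $Y:[0,1]\to\mathbb N$ are objects of type $1\to 1$ and $1\to 0$ that map equal reals in $[0,1]$ to equal values. Let $\mathrm{fin}(\mathbb R)$ be the collection of finite sequences of reals without repetitions. A family $(a_x)_{x\in[0,1]}$, given by a function $a:[0,1]\to\mathbb R$, is called Cauchy if for every real $\varepsilon>0$ there is $I\in\mathrm{fin}(\mathbb R)$ such that for all $J\in\mathrm{fin}(\mathbb R)$ with entries in $[0,1]$ and $J\cap I=\emptyset$ we have $|\sum_{x\in J}a_x|<\varepsilon$. Consider the following sentences of $\mathsf{L}_\omega$. - $\mathsf{SUM}$: if $(a_x)_{x\in[0,1]}$ is Cauchy and non-negative, then there is a sequence of reals $(y_i)_{i\in\mathbb N}$ in $[0,1]$ such that for all $y\in[0,1]$, if $y\neq y_i$ for all $i\in\mathbb N$, then $a_y=0$. - $\mathsf{NIN}$: there is no injection from $[0,1]$ to $\mathbb N$, i.e. there is no $Y:[0,1]\to\mathbb N$ such that for all $x,y\in[0,1]$, if $Y(x)=Y(y)$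 then $x=y$. **Theorem.** The system $\mathsf{RCA}_0^\omega+\mathsf{IND}$ proves $\mathsf{SUM}\to\mathsf{NIN}$. -/

import Mathlib

namespace HOA

/-! # The language of higher-order arithmetic -/

/-- The finite types: `nat` is the type `0` of natural numbers, `σ ⇒ τ` the type of maps
from objects of type `σ` to objects of type `τ`. -/
inductive Ty : Type
  | nat : Ty
  | arr (σ τ : Ty) : Ty
  deriving DecidableEq

infixr:60 " ⇒ " => Ty.arr

/-- The type `1 = 0 → 0`. -/
abbrev Ty.one : Ty := Ty.nat ⇒ Ty.nat

/-- The terms, indexed by their type. `var σ n` is the variable of type `σ` with de Bruijn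
index `n`; every type has its own indices, so a quantifier over type `σ` binds the variable
`var σ 0` and shifts the variables of type `σ` only. -/
inductive Tm : Ty → Type
  | var (σ : Ty) (n : ℕ) : Tm σ
  | zero : Tm Ty.nat
  | one : Tm Ty.nat
  | add : Tm (Ty.nat ⇒ Ty.nat ⇒ Ty.nat)
  | mul : Tm (Ty.nat ⇒ Ty.nat ⇒ Ty.nat)
  /-- the combinator `Π` (also called `K`) -/
  | combK (ρ τ : Ty) : Tm (ρ ⇒ τ ⇒ ρ)
  /-- the combinator `Σ` (also called `S`) -/
  | combS (ρ σ τ : Ty) : Tm ((ρ ⇒ σ ⇒ τ) ⇒ (ρ ⇒ σ) ⇒ ρ ⇒ τ)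
  /-- the recursor constant of type `σ` -/
  | recursor (σ : Ty) : Tm ((Ty.nat ⇒ σ ⇒ σ) ⇒ σ ⇒ Ty.nat ⇒ σ)
  | app {σ τ : Ty} (f : Tm (σ ⇒ τ)) (t : Tm σ) : Tm τ

infixl:80 " ⋄ " => Tm.app

instance : Zero (Tm Ty.nat) := ⟨Tm.zero⟩
instance : One (Tm Ty.nat) := ⟨Tm.one⟩
instance : Add (Tm Ty.nat) := ⟨fun s t => Tm.add ⋄ s ⋄ t⟩
instance : Mul (Tm Ty.nat) := ⟨fun s t => Tm.mul ⋄ s ⋄ t⟩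

/-- The formulas. Equality and order of numbers are the only primitive predicates; the logic
is classical, so `⊥`, `→`, `∀` suffice. -/
inductive Fml : Type
  | eq (s t : Tm Ty.nat) : Fml
  | lt (s t : Tm Ty.nat) : Fml
  | bot : Fml
  | imp (φ ψ : Fml) : Fml
  | all (σ : Ty) (φ : Fml) : Fml

infixr:35 " ⟹ " => Fml.imp

namespace Fml

def neg (φ : Fml) : Fml := φ ⟹ bot
def and (φ ψ : Fml) : Fml := neg (φ ⟹ neg ψ)
def or (φ ψ : Fml) : Fml := neg φ ⟹ ψ
def iff (φ ψ : Fml) : Fml := and (φ ⟹ ψ) (ψ ⟹ φ)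
def ex (σ : Ty) (φ : Fml) : Fml := neg (all σ (neg φ))
def le (s t : Tm Ty.nat) : Fml := or (lt s t) (eq s t)

/-- `k` existential number quantifiers in a row. -/
def exNat : ℕ → Fml → Fml
  | 0, φ => φ
  | k + 1, φ => ex Ty.nat (exNat k φ)

/-- Quantifier-free formulas (parameters of all finite types are allowed). -/
def QF : Fml → Prop
  | eq _ _ => True
  | lt _ _ => True
  | bot => True
  | imp φ ψ => φ.QF ∧ ψ.QF
  | all _ _ => False

end Fml

infixr:37 " ⩓ " => Fml.and
infixr:36 " ⩖ " => Fml.or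

/-! ## Substitution -/

/-- A simultaneous substitution: a term for every variable. -/
abbrev Sub : Type := (τ : Ty) → ℕ → Tm τ

def Tm.subst (s : Sub) : {τ : Ty} → Tm τ → Tm τ
  | _, .var τ n => s τ n
  | _, .zero => .zero
  | _, .one => .one
  | _, .add => .add
  | _, .mul => .mul
  | _, .combK ρ τ => .combK ρ τ
  | _, .combS ρ σ τ => .combS ρ σ τ
  | _, .recursor σ => .recursor σ
  | _, .app f t => .app (f.subst s) (t.subst s)

/-- Raise the indices of the variables of type `σ` by `k`. -/
def Sub.shift (σ : Ty) (k : ℕ) : Sub := fun τ n => Tm.var τ (if τ = σ then n + k else n)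

/-- The term `t`, to be used below `k` further quantifiers over type `σ`. -/
def Tm.up (σ : Ty) (k : ℕ) {τ : Ty} (t : Tm τ) : Tm τ := t.subst (Sub.shift σ k)

/-- The substitution `s`, to be used below a quantifier over type `σ`. -/
def Sub.under (σ : Ty) (s : Sub) : Sub := fun τ n =>
  if τ = σ then
    match n with
    | 0 => Tm.var τ 0
    | m + 1 => (s τ m).up σ 1
  else (s τ n).up σ 1

/-- Replace `var σ 0` by `t` and lower the other variables of type `σ` by one. -/
def Sub.single (σ : Ty) (t : Tm σ) : Sub := fun τ n =>
  if h : τ = σ then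
    match n with
    | 0 => h ▸ t
    | m + 1 => Tm.var τ m
  else Tm.var τ n

/-- Replace the number variable `n` with index `0` by `n + 1`, and keep all other variables. -/
def Sub.succ : Sub := fun τ n =>
  match τ, n with
  | .nat, 0 => Tm.var Ty.nat 0 + 1
  | τ, n => Tm.var τ n

/-- Capture-avoiding simultaneous substitution. -/
def Fml.subst (s : Sub) : Fml → Fml
  | .eq t u => .eq (t.subst s) (u.subst s)
  | .lt t u => .lt (t.subst s) (u.subst s)
  | .bot => .bot
  | .imp φ ψ => .imp (φ.subst s) (ψ.subst s)
  | .all σ φ => .all σ (φ.subst (s.under σ))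

/-- The formula `φ`, to be used below a further quantifier over type `σ`. -/
def Fml.up (σ : Ty) (φ : Fml) : Fml := φ.subst (Sub.shift σ 1)

/-- `φ(t)`, where `φ` is read as `φ(x)` with `x = var σ 0`. -/
def Fml.inst (σ : Ty) (t : Tm σ) (φ : Fml) : Fml := φ.subst (Sub.single σ t)

/-! ## Derivability -/

/-- Classical many-sorted natural deduction with equality of numbers. `Derives T Γ φ`: from the
axioms in `T` (free variables in axioms are read as universally quantified) and the open
assumptions in `Γ` one can derive `φ`. -/
inductive Derives (T : Set Fml) : List Fml → Fml → Prop
  | ax {Γ φ} : φ ∈ T → Derives T Γ φ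
  | hyp {Γ φ} : φ ∈ Γ → Derives T Γ φ
  | impI {Γ φ ψ} : Derives T (φ :: Γ) ψ → Derives T Γ (φ ⟹ ψ)
  | impE {Γ φ ψ} : Derives T Γ (φ ⟹ ψ) → Derives T Γ φ → Derives T Γ ψ
  | raa {Γ φ} : Derives T (φ.neg :: Γ) .bot → Derives T Γ φ
  | allI {Γ σ φ} : Derives T (Γ.map (Fml.up σ)) φ → Derives T Γ (.all σ φ)
  | allE {Γ σ φ} (t : Tm σ) : Derives T Γ (.all σ φ) → Derives T Γ (φ.inst σ t)
  | eqRefl {Γ} (t : Tm Ty.nat) : Derives T Γ (.eq t t)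
  | eqSubst {Γ} (φ : Fml) {s t : Tm Ty.nat} :
      Derives T Γ (.eq s t) → Derives T Γ (φ.inst Ty.nat s) → Derives T Γ (φ.inst Ty.nat t)

/-- The theory `T` proves `φ`. -/
def Proves (T : Set Fml) (φ : Fml) : Prop := Derives T [] φ

/-! ## The axioms -/

/-- The number variable with de Bruijn index `n`. -/
abbrev v (n : ℕ) : Tm Ty.nat := Tm.var Ty.nat n

/-- Equality of objects of type `τ = (τ₁ → ⋯ → τₖ → 0)`, that is, equality of all values
`s z₁ … zₖ` and `t z₁ … zₖ`. -/
def eqAt : (τ : Ty) → Tm τ → Tm τ → Fml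
  | .nat, s, t => Fml.eq s t
  | .arr σ τ, s, t => Fml.all σ (eqAt τ (s.up σ 1 ⋄ Tm.var σ 0) (t.up σ 1 ⋄ Tm.var σ 0))

/-- The basic axioms: the numbers form a (discretely) ordered commutative semi-ring. -/
def basicAxioms : Set Fml :=
  { .eq (v 0 + v 1 + v 2) (v 0 + (v 1 + v 2)),
    .eq (v 0 + v 1) (v 1 + v 0),
    .eq (v 0 + 0) (v 0),
    .eq (v 0 * v 1 * v 2) (v 0 * (v 1 * v 2)),
    .eq (v 0 * v 1) (v 1 * v 0),
    .eq (v 0 * 1) (v 0),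
    .eq (v 0 * 0) 0,
    .eq (v 0 * (v 1 + v 2)) (v 0 * v 1 + v 0 * v 2),
    .neg (.lt (v 0) (v 0)),
    .lt (v 0) (v 1) ⟹ .lt (v 1) (v 2) ⟹ .lt (v 0) (v 2),
    .lt (v 0) (v 1) ⩖ .eq (v 0) (v 1) ⩖ .lt (v 1) (v 0),
    .lt (v 0) (v 1) ⟹ .lt (v 0 + v 2) (v 1 + v 2),
    .lt 0 (v 2) ⟹ .lt (v 0) (v 1) ⟹ .lt (v 0 * v 2) (v 1 * v 2),
    .neg (.lt (v 0) 0),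
    .iff (.lt (v 0) (v 1 + 1)) (.le (v 0) (v 1)) }

/-- The induction axiom for `φ(n)`, with `n` the number variable of index `0`. -/
def induction (φ : Fml) : Fml :=
  φ.inst Ty.nat 0 ⟹ .all Ty.nat (φ ⟹ φ.subst Sub.succ) ⟹ .all Ty.nat φ

/-- The axiom of choice `(∀ x¹)(∃ y⁰) φ(x, y) → (∃ Y^{1 → 0})(∀ x¹) φ(x, Y(x))`, with `x` and `y`
the variables of index `0`. -/
def choiceOneZero (φ : Fml) : Fml :=
  .all Ty.one (.ex Ty.nat φ) ⟹
    .ex (Ty.one ⇒ Ty.nat) (.all Ty.one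
      ((φ.up (Ty.one ⇒ Ty.nat)).inst Ty.nat
        (Tm.var (Ty.one ⇒ Ty.nat) 0 ⋄ Tm.var Ty.one 0)))

/-- The axioms of the base theory `RCA₀^ω`. -/
inductive RCAAxiom : Fml → Prop
  | basic {φ} : φ ∈ basicAxioms → RCAAxiom φ
  | combK (ρ τ : Ty) :
      RCAAxiom (eqAt ρ (Tm.combK ρ τ ⋄ Tm.var ρ 0 ⋄ Tm.var τ 1) (Tm.var ρ 0))
  | combS (ρ σ τ : Ty) :
      RCAAxiom (eqAt τ
        (Tm.combS ρ σ τ ⋄ Tm.var (ρ ⇒ σ ⇒ τ) 0 ⋄ Tm.var (ρ ⇒ σ) 1 ⋄ Tm.var ρ 2)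
        (Tm.var (ρ ⇒ σ ⇒ τ) 0 ⋄ Tm.var ρ 2 ⋄ (Tm.var (ρ ⇒ σ) 1 ⋄ Tm.var ρ 2)))
  | recZero :
      RCAAxiom (.eq
        (Tm.recursor Ty.nat ⋄ Tm.var (Ty.nat ⇒ Ty.nat ⇒ Ty.nat) 0 ⋄ v 0 ⋄ (0 : Tm Ty.nat)) (v 0))
  | recSucc :
      RCAAxiom (.eq
        (Tm.recursor Ty.nat ⋄ Tm.var (Ty.nat ⇒ Ty.nat ⇒ Ty.nat) 0 ⋄ v 0 ⋄ (v 1 + 1))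
        (Tm.var (Ty.nat ⇒ Ty.nat ⇒ Ty.nat) 0 ⋄ v 1 ⋄
          (Tm.recursor Ty.nat ⋄ Tm.var (Ty.nat ⇒ Ty.nat ⇒ Ty.nat) 0 ⋄ v 0 ⋄ v 1)))
  | ext (ρ τ : Ty) :
      RCAAxiom (eqAt ρ (Tm.var ρ 0) (Tm.var ρ 1) ⟹
        eqAt τ (Tm.var (ρ ⇒ τ) 2 ⋄ Tm.var ρ 0) (Tm.var (ρ ⇒ τ) 2 ⋄ Tm.var ρ 1))
  | qfInd {φ : Fml} : φ.QF → RCAAxiom (induction φ)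
  | qfAC {φ : Fml} : φ.QF → RCAAxiom (choiceOneZero φ)

/-- The base theory `RCA₀^ω`. -/
def RCA0omega : Set Fml := {φ | RCAAxiom φ}

/-- `IND`: the induction axiom for all formulas. -/
def IND : Set Fml := Set.range induction

/-! ## Rational numbers -/

/-- The term `2ⁿ`, by iterated doubling. -/
def pow2 (n : Tm Ty.nat) : Tm Ty.nat :=
  let idN : Tm Ty.one :=
    Tm.combS Ty.nat Ty.one Ty.nat ⋄ Tm.combK Ty.nat Ty.one ⋄ Tm.combK Ty.nat Ty.nat
  let double : Tm Ty.one := Tm.combS Ty.nat Ty.nat Ty.nat ⋄ Tm.add ⋄ idN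
  Tm.recursor Ty.nat ⋄ (Tm.combK Ty.one Ty.nat ⋄ double) ⋄ (1 : Tm Ty.nat) ⋄ n

/-- Rationals are signed quotients, coded by numbers through the Cantor pairing
`j(a, d) = ((a + d)(a + d + 1) + 2a) / 2`: the code `j(2p, d)` stands for `p / (d + 1)`, and
`j(2q - 1, d)` with `q ≥ 1` for `- q / (d + 1)`. The formula says that `c` is the code of
`(p - q) / (d + 1)`, where `q = 0` or `p = 0` according to the sign. -/
def frac (c p q d : Tm Ty.nat) : Fml :=
  let a := v 0
  let c := c.up Ty.nat 1
  let p := p.up Ty.nat 1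
  let q := q.up Ty.nat 1
  let d := d.up Ty.nat 1
  .ex Ty.nat (.eq (c + c) ((a + d) * (a + d + 1) + (a + a)) ⩓
    ((.eq a (p + p) ⩓ .eq q 0) ⩖ (.eq (a + 1) (q + q) ⩓ .eq p 0)))

/-- For rational codes `r`, `s` and numbers `k`, `n`: the comparison of `r` with `s + k · 2⁻ⁿ`,
after clearing denominators. -/
def qCmp (cmp : Tm Ty.nat → Tm Ty.nat → Fml) (r s k n : Tm Ty.nat) : Fml :=
  let p := v 5
  let q := v 4
  let d := v 3
  let p' := v 2
  let q' := v 1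
  let d' := v 0
  let k := k.up Ty.nat 6
  let e := pow2 (n.up Ty.nat 6)
  .exNat 6 (frac (r.up Ty.nat 6) p q d ⩓ frac (s.up Ty.nat 6) p' q' d' ⩓
    cmp (p * (d' + 1) * e + q' * (d + 1) * e)
      (p' * (d + 1) * e + q * (d' + 1) * e + k * (d + 1) * (d' + 1)))

/-- `r < s + k · 2⁻ⁿ` for rational codes `r`, `s`. -/
def qLt (r s k n : Tm Ty.nat) : Fml := qCmp Fml.lt r s k n

/-- `r ≤ s + k · 2⁻ⁿ` for rational codes `r`, `s`. -/
def qLe (r s k n : Tm Ty.nat) : Fml := qCmp Fml.le r s k n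

/-- `u = r + s` for rational codes `r`, `s`, `u` (equality of rationals). -/
def qAdd (r s u : Tm Ty.nat) : Fml :=
  let p := v 8
  let q := v 7
  let d := v 6
  let p' := v 5
  let q' := v 4
  let d' := v 3
  let p'' := v 2
  let q'' := v 1
  let d'' := v 0
  .exNat 9 (frac (r.up Ty.nat 9) p q d ⩓ frac (s.up Ty.nat 9) p' q' d' ⩓
    frac (u.up Ty.nat 9) p'' q'' d'' ⩓
    .eq ((p * (d' + 1) + p' * (d + 1)) * (d'' + 1) + q'' * (d + 1) * (d' + 1))
      (p'' * (d + 1) * (d' + 1) + (q * (d' + 1) + q' * (d + 1)) * (d'' + 1)))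

/-- `u = |r|` for rational codes `r`, `u`. -/
def qAbs (r u : Tm Ty.nat) : Fml :=
  let p := v 2
  let q := v 1
  let d := v 0
  .exNat 3 (frac (r.up Ty.nat 3) p q d ⩓ frac (u.up Ty.nat 3) (p + q) 0 d)

/-! ## Real numbers -/

/-- `x ∈ ℝ`: the type `1` object `x` is a sequence of (codes of) rationals with
`|xₙ - xₙ₊ᵢ| < 2⁻ⁿ` for all `n`, `i`. -/
def isReal (x : Tm Ty.one) : Fml :=
  let n := v 1
  let i := v 0
  let x := x.up Ty.nat 2
  .all Ty.nat (.all Ty.nat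
    (qLt (x ⋄ n) (x ⋄ (n + i)) 1 n ⩓ qLt (x ⋄ (n + i)) (x ⋄ n) 1 n))

/-- `x ≤ y` for reals: `xₙ ≤ yₙ + 2⁻ⁿ⁺¹` for all `n`. -/
def leR (x y : Tm Ty.one) : Fml :=
  .all Ty.nat (qLe (x.up Ty.nat 1 ⋄ v 0) (y.up Ty.nat 1 ⋄ v 0) (1 + 1) (v 0))

/-- `x = y` for reals: `|xₙ - yₙ| ≤ 2⁻ⁿ⁺¹` for all `n`. -/
def eqR (x y : Tm Ty.one) : Fml := leR x y ⩓ leR y x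

/-- `x < y` for reals: `xₙ + 2⁻ⁿ⁺¹ < yₙ` for some `n`. -/
def ltR (x y : Tm Ty.one) : Fml := .neg (leR y x)

/-- `|x| < y` for reals, with `|x|` the sequence of the `|xₙ|`. -/
def absLtR (x y : Tm Ty.one) : Fml :=
  let n := v 1
  let u := v 0
  let x := x.up Ty.nat 2
  let y := y.up Ty.nat 2
  .exNat 2 (qAbs (x ⋄ n) u ⩓ .neg (qLe (y ⋄ n) u (1 + 1) n))

/-- `z` is a sequence representing the sum of the reals `x` and `y`:
`zₙ = xₙ₊₁ + yₙ₊₁` for all `n`. -/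
def addR (x y z : Tm Ty.one) : Fml :=
  let n := v 0
  .all Ty.nat (qAdd (x.up Ty.nat 1 ⋄ (n + 1)) (y.up Ty.nat 1 ⋄ (n + 1)) (z.up Ty.nat 1 ⋄ n))

/-- The real `0`; the number `0` is the code of the rational `0`. -/
def zeroR : Tm Ty.one := Tm.combK Ty.nat Ty.nat ⋄ (0 : Tm Ty.nat)

/-- The real `1`; the number `5 = j(2, 0)` is the code of the rational `1`. -/
def oneR : Tm Ty.one := Tm.combK Ty.nat Ty.nat ⋄ (1 + 1 + 1 + 1 + 1 : Tm Ty.nat)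

/-- `x ∈ [0,1]`. -/
def inUnit (x : Tm Ty.one) : Fml := isReal x ⩓ leR zeroR x ⩓ leR x oneR

/-! ## Functions on the unit interval and finite sequences of reals -/

/-- `Y : [0,1] → ℕ`: equal reals have equal values. -/
def isFunNat (Y : Tm (Ty.one ⇒ Ty.nat)) : Fml :=
  let x := Tm.var Ty.one 1
  let y := Tm.var Ty.one 0
  let Y := Y.up Ty.one 2
  .all Ty.one (.all Ty.one
    (inUnit x ⟹ inUnit y ⟹ eqR x y ⟹ .eq (Y ⋄ x) (Y ⋄ y)))

/-- `a : [0,1] → ℝ`: values are reals, and equal reals have equal values. -/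
def isFunReal (a : Tm (Ty.one ⇒ Ty.one)) : Fml :=
  (.all Ty.one (inUnit (Tm.var Ty.one 0) ⟹ isReal (a.up Ty.one 1 ⋄ Tm.var Ty.one 0))) ⩓
  (let x := Tm.var Ty.one 1
   let y := Tm.var Ty.one 0
   let a := a.up Ty.one 2
   .all Ty.one (.all Ty.one
     (inUnit x ⟹ inUnit y ⟹ eqR x y ⟹ eqR (a ⋄ x) (a ⋄ y))))

/-- The type of sequences of type `1` objects. A finite sequence `⟨w₀, …, w_{N-1}⟩` of such
objects is given by its length `N` and a sequence with these first `N` entries. -/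
abbrev Ty.seq : Ty := Ty.nat ⇒ Ty.one

/-- `⟨w₀, …, w_{N-1}⟩ ∈ fin(ℝ)`: a finite sequence of reals without repetitions. -/
def isFin (w : Tm Ty.seq) (N : Tm Ty.nat) : Fml :=
  (.all Ty.nat (.lt (v 0) (N.up Ty.nat 1) ⟹ isReal (w.up Ty.nat 1 ⋄ v 0))) ⩓
  (let i := v 1
   let j := v 0
   let w := w.up Ty.nat 2
   let N := N.up Ty.nat 2
   .all Ty.nat (.all Ty.nat (.lt i N ⟹ .lt j i ⟹ .neg (eqR (w ⋄ i) (w ⋄ j)))))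

/-- All entries of `⟨w₀, …, w_{N-1}⟩` are in `[0,1]`. -/
def finInUnit (w : Tm Ty.seq) (N : Tm Ty.nat) : Fml :=
  .all Ty.nat (.lt (v 0) (N.up Ty.nat 1) ⟹ inUnit (w.up Ty.nat 1 ⋄ v 0))

/-- `⟨w₀, …, w_{N-1}⟩` and `⟨u₀, …, u_{M-1}⟩` have no real in common. -/
def finDisjoint (w : Tm Ty.seq) (N : Tm Ty.nat) (u : Tm Ty.seq) (M : Tm Ty.nat) : Fml :=
  let i := v 1
  let j := v 0
  let w := w.up Ty.nat 2
  let N := N.up Ty.nat 2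
  let u := u.up Ty.nat 2
  let M := M.up Ty.nat 2
  .all Ty.nat (.all Ty.nat (.lt i N ⟹ .lt j M ⟹ .neg (eqR (w ⋄ i) (u ⋄ j))))

/-- `s₀, …, s_N` are the partial sums of `a(w₀), …, a(w_{N-1})`: `s₀` is the real `0`, and
`s_{i+1}` represents `s_i + a(w_i)` for `i < N`. -/
def partialSums (a : Tm (Ty.one ⇒ Ty.one)) (w : Tm Ty.seq) (N : Tm Ty.nat) (s : Tm Ty.seq) :
    Fml :=
  let i := v 0
  let a := a.up Ty.nat 1
  let w := w.up Ty.nat 1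
  let s' := s.up Ty.nat 1
  eqAt Ty.one (s ⋄ (0 : Tm Ty.nat)) zeroR ⩓
  .all Ty.nat (.lt i (N.up Ty.nat 1) ⟹ addR (s' ⋄ i) (a ⋄ (w ⋄ i)) (s' ⋄ (i + 1)))

/-- `|∑_{x ∈ w} a_x| < ε`, for the finite sequence `w` of length `N`. -/
def absSumLt (a : Tm (Ty.one ⇒ Ty.one)) (w : Tm Ty.seq) (N : Tm Ty.nat) (ε : Tm Ty.one) : Fml :=
  let s := Tm.var Ty.seq 0
  .ex Ty.seq (partialSums (a.up Ty.seq 1) (w.up Ty.seq 1) (N.up Ty.seq 1) s ⩓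
    absLtR (s ⋄ N.up Ty.seq 1) (ε.up Ty.seq 1))

/-! ## The principles -/

/-- The Cauchy criterion for the unordered sum of `(a_x)_{x ∈ [0,1]}`: for every real `ε > 0` there
is `I ∈ fin(ℝ)` such that `|∑_{x ∈ J} a_x| < ε` for all `J ∈ fin(ℝ)` (in the domain of `a`) with
`J ∩ I = ∅`. -/
def isCauchy (a : Tm (Ty.one ⇒ Ty.one)) : Fml :=
  let ε := Tm.var Ty.one 0
  .all Ty.one (isReal ε ⟹ ltR zeroR ε ⟹
    .ex Ty.seq (.ex Ty.nat
      (isFin (Tm.var Ty.seq 0) (v 0) ⩓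
        .all Ty.seq (.all Ty.nat
          (let I := Tm.var Ty.seq 1
           let N := v 1
           let J := Tm.var Ty.seq 0
           let M := v 0
           let a := ((a.up Ty.one 1).up Ty.seq 2).up Ty.nat 2
           isFin J M ⟹ finInUnit J M ⟹ finDisjoint J M I N ⟹ absSumLt a J M ε)))))

/-- `SUM`: if `(a_x)_{x ∈ [0,1]}` is Cauchy and non-negative, then there is a sequence `(y_i)` in
`[0,1]` such that `a_x = 0` whenever `x ∈ [0,1]` differs from all `y_i`. -/
def SUM : Fml :=
  let a := Tm.var (Ty.one ⇒ Ty.one) 0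
  let x := Tm.var Ty.one 0
  let y := Tm.var Ty.seq 0
  .all (Ty.one ⇒ Ty.one)
    (isFunReal a ⟹
      .all Ty.one (inUnit x ⟹ leR zeroR (a ⋄ x)) ⟹
      isCauchy a ⟹
      .ex Ty.seq
        (.all Ty.nat (inUnit (y ⋄ v 0)) ⩓
          .all Ty.one (inUnit x ⟹ .all Ty.nat (.neg (eqR x (y ⋄ v 0))) ⟹ eqR (a ⋄ x) zeroR)))

/-- `NIN`: there is no injection from `[0,1]` to `ℕ`. -/
def NIN : Fml :=
  let Y := Tm.var (Ty.one ⇒ Ty.nat) 0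
  let x := Tm.var Ty.one 1
  let y := Tm.var Ty.one 0
  .neg (.ex (Ty.one ⇒ Ty.nat)
    (isFunNat Y ⩓
      .all Ty.one (.all Ty.one
        (inUnit x ⟹ inUnit y ⟹ .eq (Y ⋄ x) (Y ⋄ y) ⟹ eqR x y))))

end HOA

/-! Derivability is reduced to truth in models by a Henkin completeness proof (`proves_of_models`).
The language is countable, and a maximal consistent set with witnesses yields the structure of terms
modulo provable equality. Equality at higher types is equality of all values, so this structure is
extensional, and the extensionality axioms are what makes application well defined on classes. Every
object is named by a term, so definability with parameters is definability by terms and formulas.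

The mathematics then takes place in an arbitrary model of the theory, whose numbers may be
nonstandard. The available tools are induction for definable predicates, primitive recursion on
numbers, combinatory abstraction and quantifier-free choice. Codes of rationals are read in the
ordered field of fractions of the numbers of the model (`Frac`), where ordinary ordered-field
reasoning applies.

Suppose that `Y` is an injection from the unit interval to the numbers, and put `a x = 2^{-(Y x +
1)}`. By induction on `k`, the reals `x` with `Y x < k` form a finite sequence (`exists_list`); this
formula quantifies over reals and over sequences, so it needs more than quantifier-free induction. A
finite sequence disjoint from that one has distinct `Y`-values, all at least `k`, so its sum is at
most `2^{-k}` (`exists_sums`), and the family is Cauchy (`isCauchy_of_rat_eq`). As `a` never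
vanishes, `SUM` gives a sequence that lists the whole unit interval, which Cantor's nested intervals
refute (`exists_diagonal`). -/

namespace HOA

/-! ## Extending assignments to variables -/

/-- Assign `a` to `var σ 0` and shift the values at the other variables of type `σ`. -/
def cons {C : Ty → Type*} (σ : Ty) (a : C σ) (ρ : (τ : Ty) → ℕ → C τ) : (τ : Ty) → ℕ → C τ :=
  fun τ n =>
    if h : τ = σ then
      match n with
      | 0 => h ▸ a
      | m + 1 => ρ τ m
    else ρ τ n

section cons

variable {C D : Ty → Type*}

@[simp] theorem cons_zero (σ : Ty) (a : C σ) (ρ : (τ : Ty) → ℕ → C τ) : cons σ a ρ σ 0 = a := by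
  simp [cons]

@[simp] theorem cons_succ (σ : Ty) (a : C σ) (ρ : (τ : Ty) → ℕ → C τ) (n : ℕ) :
    cons σ a ρ σ (n + 1) = ρ σ n := by
  simp [cons]

@[simp] theorem cons_ne {σ τ : Ty} (h : τ ≠ σ) (a : C σ) (ρ : (τ : Ty) → ℕ → C τ) (n : ℕ) :
    cons σ a ρ τ n = ρ τ n := by
  simp [cons, h]

theorem cons_map (f : (τ : Ty) → C τ → D τ) (σ : Ty) (a : C σ) (ρ : (τ : Ty) → ℕ → C τ) (τ : Ty)
    (n : ℕ) : f τ (cons σ a ρ τ n) = cons σ (f σ a) (fun τ n => f τ (ρ τ n)) τ n := by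
  by_cases h : τ = σ
  · subst h
    cases n <;> simp
  · simp [cons_ne h]

theorem cons_shift (σ : Ty) (a : C σ) (ρ : (τ : Ty) → ℕ → C τ) (τ : Ty) (n : ℕ) :
    cons σ a ρ τ (if τ = σ then n + 1 else n) = ρ τ n := by
  by_cases h : τ = σ
  · subst h
    simp
  · simp [h]

theorem cons_eta (σ : Ty) (ρ : (τ : Ty) → ℕ → C τ) :
    cons σ (ρ σ 0) (fun τ n => ρ τ (if τ = σ then n + 1 else n)) = ρ := by
  funext κ n
  by_cases h : κ = σ
  · subst h
    cases n <;> simp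
  · simp [h]

end cons

/-! ## Substitution -/

theorem Sub.single_eq (σ : Ty) (t : Tm σ) : Sub.single σ t = cons σ t Tm.var := rfl

theorem Sub.under_eq (σ : Ty) (s : Sub) :
    s.under σ = cons σ (Tm.var σ 0) (fun τ n => (s τ n).up σ 1) := by
  funext τ n
  by_cases h : τ = σ
  · subst h
    cases n <;> simp [Sub.under]
  · simp [Sub.under, h]

theorem Tm.subst_subst (s s' : Sub) {τ : Ty} (t : Tm τ) :
    (t.subst s).subst s' = t.subst fun τ n => (s τ n).subst s' := by
  induction t with
  | app f t ihf iht => simp [Tm.subst, ihf, iht]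
  | _ => rfl

theorem Tm.subst_var {τ : Ty} (t : Tm τ) : t.subst Tm.var = t := by
  induction t with
  | app f t ihf iht => simp [Tm.subst, ihf, iht]
  | _ => rfl

theorem Tm.up_subst_cons (σ : Ty) (a : Tm σ) (s : Sub) {τ : Ty} (t : Tm τ) :
    (t.up σ 1).subst (cons σ a s) = t.subst s := by
  rw [Tm.up, Tm.subst_subst]
  congr 1
  funext κ n
  exact cons_shift σ a s κ n

theorem Tm.up_subst_under (σ : Ty) (s : Sub) {τ : Ty} (t : Tm τ) :
    (t.up σ 1).subst (s.under σ) = (t.subst s).up σ 1 := by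
  rw [Sub.under_eq, Tm.up_subst_cons, Tm.up, Tm.subst_subst]
  rfl

theorem Sub.under_var (σ : Ty) : Sub.under σ Tm.var = Tm.var := by
  rw [Sub.under_eq]
  exact cons_eta σ Tm.var

theorem Sub.under_comp (σ : Ty) (s s' : Sub) :
    (fun τ n => (s.under σ τ n).subst (s'.under σ)) =
      Sub.under σ (fun τ n => (s τ n).subst s') := by
  funext τ n
  rw [Sub.under_eq σ s, cons_map (fun τ (t : Tm τ) => t.subst (s'.under σ)),
    Sub.under_eq σ (fun τ n => (s τ n).subst s')]
  simp only [Tm.up_subst_under]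
  rw [Tm.subst, Sub.under_eq, cons_zero]

theorem Fml.subst_subst (s s' : Sub) (φ : Fml) :
    (φ.subst s).subst s' = φ.subst fun τ n => (s τ n).subst s' := by
  induction φ generalizing s s' with
  | eq t u => simp [Fml.subst, Tm.subst_subst]
  | lt t u => simp [Fml.subst, Tm.subst_subst]
  | bot => rfl
  | imp φ ψ ihφ ihψ => simp [Fml.subst, ihφ, ihψ]
  | all σ φ ih => simp [Fml.subst, ih, Sub.under_comp]

theorem Fml.subst_var (φ : Fml) : φ.subst Tm.var = φ := by
  induction φ with
  | eq t u => simp [Fml.subst, Tm.subst_var]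
  | lt t u => simp [Fml.subst, Tm.subst_var]
  | bot => rfl
  | imp φ ψ ihφ ihψ => simp [Fml.subst, ihφ, ihψ]
  | all σ φ ih => simp [Fml.subst, ih, Sub.under_var]

theorem Fml.under_inst (σ : Ty) (s : Sub) (t : Tm σ) (φ : Fml) :
    (φ.subst (s.under σ)).inst σ t = φ.subst (cons σ t s) := by
  rw [Fml.inst, Fml.subst_subst, Sub.single_eq]
  congr 1
  funext τ n
  rw [Sub.under_eq, cons_map (fun τ (u : Tm τ) => u.subst (cons σ t Tm.var))]
  simp only [Tm.up_subst_cons, Tm.subst_var, Tm.subst, cons_zero]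

theorem Fml.inst_subst (σ : Ty) (s : Sub) (t : Tm σ) (φ : Fml) :
    (φ.inst σ t).subst s = φ.subst (cons σ (t.subst s) s) := by
  rw [Fml.inst, Fml.subst_subst, Sub.single_eq]
  congr 1
  funext τ n
  rw [cons_map (fun τ (u : Tm τ) => u.subst s)]
  rfl

/-- `φ` depends only on the variables of the types in `l` with index below `k`. -/
def Fml.Supp (l : List Ty) (k : ℕ) (φ : Fml) : Prop :=
  ∀ s s' : Sub, (∀ τ ∈ l, ∀ n < k, s τ n = s' τ n) → φ.subst s = φ.subst s'

def Tm.Supp (l : List Ty) (k : ℕ) {σ : Ty} (t : Tm σ) : Prop :=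
  ∀ s s' : Sub, (∀ τ ∈ l, ∀ n < k, s τ n = s' τ n) → t.subst s = t.subst s'

theorem Tm.Supp.mono {l l' : List Ty} {k k' : ℕ} {σ : Ty} {t : Tm σ} (h : t.Supp l k)
    (hl : l ⊆ l') (hk : k ≤ k') : t.Supp l' k' :=
  fun s s' H => h s s' fun τ hτ n hn => H τ (hl hτ) n (hn.trans_le hk)

theorem Fml.Supp.mono {l l' : List Ty} {k k' : ℕ} {φ : Fml} (h : φ.Supp l k)
    (hl : l ⊆ l') (hk : k ≤ k') : φ.Supp l' k' :=
  fun s s' H => h s s' fun τ hτ n hn => H τ (hl hτ) n (hn.trans_le hk)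

theorem Tm.exists_supp {σ : Ty} (t : Tm σ) : ∃ l k, t.Supp l k := by
  induction t with
  | var σ n => exact ⟨[σ], n + 1, fun s s' h => h σ (by simp) n (by simp)⟩
  | app f t ihf iht =>
    obtain ⟨l, k, h⟩ := ihf
    obtain ⟨l', k', h'⟩ := iht
    refine ⟨l ++ l', max k k', fun s s' H => ?_⟩
    simp only [Tm.subst]
    rw [h.mono (by simp) (le_max_left _ _) s s' H, h'.mono (by simp) (le_max_right _ _) s s' H]
  | _ => exact ⟨[], 0, fun s s' _ => rfl⟩

theorem Fml.exists_supp (φ : Fml) : ∃ l k, φ.Supp l k := by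
  induction φ with
  | eq t u =>
    obtain ⟨l, k, h⟩ := t.exists_supp
    obtain ⟨l', k', h'⟩ := u.exists_supp
    refine ⟨l ++ l', max k k', fun s s' H => ?_⟩
    simp only [Fml.subst]
    rw [h.mono (by simp) (le_max_left _ _) s s' H, h'.mono (by simp) (le_max_right _ _) s s' H]
  | lt t u =>
    obtain ⟨l, k, h⟩ := t.exists_supp
    obtain ⟨l', k', h'⟩ := u.exists_supp
    refine ⟨l ++ l', max k k', fun s s' H => ?_⟩
    simp only [Fml.subst]
    rw [h.mono (by simp) (le_max_left _ _) s s' H, h'.mono (by simp) (le_max_right _ _) s s' H]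
  | bot => exact ⟨[], 0, fun s s' _ => rfl⟩
  | imp φ ψ ihφ ihψ =>
    obtain ⟨l, k, h⟩ := ihφ
    obtain ⟨l', k', h'⟩ := ihψ
    refine ⟨l ++ l', max k k', fun s s' H => ?_⟩
    simp only [Fml.subst]
    rw [h.mono (by simp) (le_max_left _ _) s s' H, h'.mono (by simp) (le_max_right _ _) s s' H]
  | all σ φ ih =>
    obtain ⟨l, k, h⟩ := ih
    refine ⟨l, k, fun s s' H => ?_⟩
    simp only [Fml.subst]
    rw [h (s.under σ) (s'.under σ)]
    intro τ hτ n hn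
    by_cases hσ : τ = σ
    · subst hσ
      cases n with
      | zero => simp [Sub.under_eq]
      | succ n => simp [Sub.under_eq, H τ hτ n (by omega)]
    · simp [Sub.under_eq, cons_ne hσ, H τ hτ n hn]

theorem Fml.exists_supp_list (Γ : List Fml) : ∃ l k, ∀ φ ∈ Γ, φ.Supp l k := by
  induction Γ with
  | nil => exact ⟨[], 0, by simp⟩
  | cons φ Γ ih =>
    obtain ⟨l, k, h⟩ := φ.exists_supp
    obtain ⟨l', k', h'⟩ := ih
    refine ⟨l ++ l', max k k', fun ψ hψ => ?_⟩
    rcases List.mem_cons.1 hψ with rfl | hψ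
    · exact h.mono (by simp) (le_max_left _ _)
    · exact (h' ψ hψ).mono (by simp) (le_max_right _ _)

/-! ## Structural properties of derivability -/

namespace Derives

variable {T : Set Fml}

theorem weaken {Γ Δ : List Fml} {φ : Fml} (h : Derives T Γ φ) (hs : Γ ⊆ Δ) : Derives T Δ φ := by
  induction h generalizing Δ with
  | ax h => exact .ax h
  | hyp h => exact .hyp (hs h)
  | impI _ ih => exact .impI (ih (List.cons_subset_cons _ hs))
  | impE _ _ ih₁ ih₂ => exact .impE (ih₁ hs) (ih₂ hs)
  | raa _ ih => exact .raa (ih (List.cons_subset_cons _ hs))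
  | allI _ ih => exact .allI (ih (List.map_subset _ hs))
  | allE t _ ih => exact .allE t (ih hs)
  | eqRefl t => exact .eqRefl t
  | eqSubst φ _ _ ih₁ ih₂ => exact .eqSubst φ (ih₁ hs) (ih₂ hs)

theorem cut {Γ : List Fml} {φ ψ : Fml} (h : Derives T Γ φ) (h' : Derives T (φ :: Γ) ψ) :
    Derives T Γ ψ :=
  .impE (.impI h') h

/-- The prefix of universal quantifiers over the types in `l`, the last one outermost. -/
def alls : List Ty → Fml → Fml
  | [], φ => φ
  | σ :: l, φ => alls l (.all σ φ)

theorem alls_intro {φ : Fml} (h : Derives T [] φ) (l : List Ty) : Derives T [] (alls l φ) := by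
  induction l generalizing φ with
  | nil => exact h
  | cons σ l ih => exact ih (.allI h)

/-- A substitution splits into its value at `var σ 0` and the remaining tail: the tail is passed to
the outer quantifiers, and the value instantiates the innermost one. -/
theorem alls_elim {Γ : List Fml} (l : List Ty) (φ : Fml)
    (h : ∀ s, Derives T Γ ((alls l φ).subst s)) (s : Sub) : Derives T Γ (φ.subst s) := by
  induction l generalizing φ s with
  | nil => exact h s
  | cons σ l ih =>
    have := (ih (.all σ φ) h fun τ n => s τ (if τ = σ then n + 1 else n)).allE (s σ 0)
    rwa [Fml.under_inst, cons_eta] at this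

/-- The effect of `s` below the quantifiers of `alls l`. -/
def unders : List Ty → Sub → Sub
  | [], s => s
  | σ :: l, s => (unders l s).under σ

theorem alls_subst (l : List Ty) (φ : Fml) (s : Sub) :
    (alls l φ).subst s = alls l (φ.subst (unders l s)) := by
  induction l generalizing φ with
  | nil => rfl
  | cons σ l ih => exact ih (.all σ φ)

theorem unders_apply (l : List Ty) (s : Sub) (τ : Ty) (n : ℕ) (hn : n < l.count τ) :
    unders l s τ n = Tm.var τ n := by
  induction l generalizing n with
  | nil => simp at hn
  | cons σ l ih =>
    rw [unders, Sub.under_eq]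
    by_cases h : τ = σ
    · subst h
      cases n with
      | zero => simp
      | succ n =>
        rw [List.count_cons_self] at hn
        simp [ih n (by omega), Tm.up, Tm.subst, Sub.shift]
    · rw [List.count_cons_of_ne (Ne.symm h)] at hn
      simp [ih n hn, Tm.up, Tm.subst, Sub.shift, h]

/-- An induction on derivations would fail at the axioms, since `T` need not be closed under
substitution. Instead all variables of `φ` are quantified, and the prefix is then instantiated by
the values of `s`. -/
theorem subst_of_nil {φ : Fml} (h : Derives T [] φ) (Γ : List Fml) (s : Sub) :
    Derives T Γ (φ.subst s) := by
  obtain ⟨L, k, hφ⟩ := φ.exists_supp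
  -- Each type in the support occurs at least `k` times in the prefix, so every variable on which
  -- `φ` depends is bound and substitution leaves the closed formula unchanged.
  refine alls_elim (List.replicate k L).flatten φ (fun s => ?_) s
  rw [alls_subst, hφ _ Tm.var, Fml.subst_var]
  · exact (alls_intro h _).weaken (List.nil_subset _)
  · intro τ hτ n hn
    refine unders_apply _ _ _ _ (hn.trans_le ?_)
    rw [List.count_flatten]
    simpa using Nat.le_mul_of_pos_right k (List.count_pos_iff.2 hτ)

theorem subst {Γ : List Fml} {φ : Fml} (h : Derives T Γ φ) (s : Sub) :
    Derives T (Γ.map (Fml.subst s)) (φ.subst s) := by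
  induction Γ generalizing φ with
  | nil => exact h.subst_of_nil _ s
  | cons ψ Γ ih =>
    exact .impE ((ih h.impI).weaken (List.subset_cons_self _ _)) (.hyp (by simp))

/-- Generalization on a variable that does not occur elsewhere. -/
theorem all_of_fresh {Γ : List Fml} {σ : Ty} {φ : Fml} {l : List Ty} {N : ℕ}
    (hs : ∀ ψ ∈ φ :: Γ, ψ.Supp l N) (h : Derives T Γ (φ.inst σ (Tm.var σ N))) :
    Derives T Γ (.all σ φ) := by
  -- `s` moves the fresh variable to index `0` and raises all others of type `σ`. On the support of
  -- `Γ`, where indices are below `N`, it agrees with the shift required by `allI`; on the instance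
  -- of `φ` it undoes the instantiation.
  set s : Sub := fun τ n =>
    if τ = σ then (if n = N then Tm.var τ 0 else Tm.var τ (n + 1)) else Tm.var τ n with hsdef
  have h' := h.subst s
  rw [Fml.inst_subst, hs φ (by simp) _ Tm.var, Fml.subst_var] at h'
  · refine .allI ?_
    convert h' using 1
    refine List.map_congr_left fun ψ hψ => hs ψ (by simp [hψ]) _ _ fun τ _ n hn => ?_
    by_cases hτ : τ = σ
    · simp [Sub.shift, hsdef, hτ, hn.ne]
    · simp [Sub.shift, hsdef, hτ]
  · intro τ _ n hn
    by_cases hτ : τ = σ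
    · subst hτ
      cases n with
      | zero => simp [Tm.subst, hsdef]
      | succ n => simp [hsdef, (show n ≠ N by omega)]
    · simp [hsdef, hτ]

end Derives

/-! ## Countability of the language -/

def Ty.code : Ty → ℕ
  | .nat => 0
  | .arr σ τ => Nat.pair σ.code τ.code + 1

theorem Ty.code_injective : Function.Injective Ty.code := by
  intro σ
  induction σ with
  | nat => intro τ h; cases τ <;> simp_all [Ty.code]
  | arr σ τ ihσ ihτ =>
    intro κ h
    cases κ with
    | nat => simp [Ty.code] at h
    | arr σ' τ' =>
      simp only [Ty.code, Nat.add_right_cancel_iff, Nat.pair_eq_pair] at h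
      rw [ihσ h.1, ihτ h.2]

def Tm.code : {σ : Ty} → Tm σ → ℕ
  | _, .var σ n => Nat.pair 0 (Nat.pair σ.code n)
  | _, .zero => Nat.pair 1 0
  | _, .one => Nat.pair 2 0
  | _, .add => Nat.pair 3 0
  | _, .mul => Nat.pair 4 0
  | _, .combK ρ τ => Nat.pair 5 (Nat.pair ρ.code τ.code)
  | _, .combS ρ σ τ => Nat.pair 6 (Nat.pair ρ.code (Nat.pair σ.code τ.code))
  | _, .recursor σ => Nat.pair 7 σ.code
  | _, .app f t => Nat.pair 8 (Nat.pair f.code t.code)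

/-- The types are part of the conclusion because the type of an application does not determine the
argument type; the induction has to recover it from the codes. -/
theorem Tm.code_injective {σ σ' : Ty} (t : Tm σ) (t' : Tm σ') (h : t.code = t'.code) :
    (⟨σ, t⟩ : Σ σ, Tm σ) = ⟨σ', t'⟩ := by
  induction t generalizing σ' with
  | app f t ihf iht =>
    cases t' with
    | app f' t' =>
      simp only [Tm.code, Nat.pair_eq_pair, true_and] at h
      have h₁ := ihf _ h.1
      have h₂ := iht _ h.2
      simp only [Sigma.mk.injEq, Ty.arr.injEq] at h₁ h₂
      obtain ⟨⟨rfl, rfl⟩, h₁⟩ := h₁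
      obtain ⟨-, h₂⟩ := h₂
      rw [eq_of_heq h₁, eq_of_heq h₂]
    | _ => simp [Tm.code, Nat.pair_eq_pair] at h
  | _ =>
    cases t' <;> simp only [Tm.code, Nat.pair_eq_pair, true_and, and_true, false_and,
      OfNat.ofNat_ne_zero, OfNat.zero_ne_ofNat, Nat.reduceEqDiff, OfNat.one_ne_ofNat,
      OfNat.ofNat_ne_one, one_ne_zero, zero_ne_one, Ty.code_injective.eq_iff] at h <;>
    first
      | rfl
      | (obtain ⟨rfl, rfl, rfl⟩ := h; rfl)

def Fml.code : Fml → ℕ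
  | .eq t u => Nat.pair 0 (Nat.pair t.code u.code)
  | .lt t u => Nat.pair 1 (Nat.pair t.code u.code)
  | .bot => Nat.pair 2 0
  | .imp φ ψ => Nat.pair 3 (Nat.pair φ.code ψ.code)
  | .all σ φ => Nat.pair 4 (Nat.pair σ.code φ.code)

theorem Tm.code_inj {σ : Ty} {t t' : Tm σ} : t.code = t'.code ↔ t = t' :=
  ⟨fun h => by simpa using t.code_injective t' h, fun h => h ▸ rfl⟩

theorem Fml.code_injective : Function.Injective Fml.code := by
  intro φ
  induction φ with
  | imp φ ψ ih₁ ih₂ =>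
    intro χ h
    cases χ <;> simp [Fml.code, Nat.pair_eq_pair] at h
    rw [ih₁ h.1, ih₂ h.2]
  | all σ φ ih =>
    intro χ h
    cases χ <;> simp [Fml.code, Nat.pair_eq_pair] at h
    rw [Ty.code_injective h.1, ih h.2]
  | _ =>
    intro χ h
    cases χ <;> simp_all [Fml.code, Nat.pair_eq_pair, Tm.code_inj]

instance : Nonempty Fml := ⟨.bot⟩

instance : Countable Fml := Fml.code_injective.countable

/-! ## Henkin sets -/

/-- A maximal consistent set of formulas with witnesses. -/
structure Henkin (T : Set Fml) where
  mem : Set Fml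
  closed {Γ : List Fml} {φ : Fml} : (∀ ψ ∈ Γ, ψ ∈ mem) → Derives T Γ φ → φ ∈ mem
  bot_notMem : Fml.bot ∉ mem
  mem_or_neg (φ : Fml) : φ ∈ mem ∨ φ.neg ∈ mem
  witness {σ : Ty} {φ : Fml} : (Fml.all σ φ).neg ∈ mem → ∃ t, (φ.inst σ t).neg ∈ mem

def Consistent (T : Set Fml) (Γ : List Fml) : Prop := ¬ Derives T Γ .bot

/-- No Henkin constants are needed: `Γ` is finite, so some variable of type `σ` is fresh and serves
as the witness. -/
theorem Consistent.exists_witness {T : Set Fml} {Γ : List Fml} {σ : Ty} {φ : Fml}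
    (h : Consistent T ((Fml.all σ φ).neg :: Γ)) :
    ∃ t, Consistent T ((φ.inst σ t).neg :: (Fml.all σ φ).neg :: Γ) := by
  obtain ⟨l, N, hs⟩ := Fml.exists_supp_list (φ :: (Fml.all σ φ).neg :: Γ)
  refine ⟨Tm.var σ N, fun h' => h ?_⟩
  exact .impE (.hyp (by simp [Fml.neg])) (Derives.all_of_fresh hs (.raa h'))

theorem Consistent.step {T : Set Fml} {Γ : List Fml} (h : Consistent T Γ) (φ : Fml) :
    ∃ Δ, Consistent T Δ ∧ Γ ⊆ Δ ∧ (φ ∈ Δ ∨ φ.neg ∈ Δ) ∧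
      ∀ σ ψ, φ = .all σ ψ → φ ∈ Δ ∨ ∃ t, (ψ.inst σ t).neg ∈ Δ := by
  by_cases hφ : Consistent T (φ :: Γ)
  · exact ⟨φ :: Γ, hφ, List.subset_cons_self _ _, by simp, fun _ _ _ => by simp⟩
  have hn : Consistent T (φ.neg :: Γ) := fun h' => hφ fun hc =>
    h (Derives.cut (Derives.impI (not_not.1 hφ)) h') |>.elim
  by_cases ha : ∃ σ ψ, φ = .all σ ψ
  · obtain ⟨σ, ψ, rfl⟩ := ha
    obtain ⟨t, ht⟩ := hn.exists_witness
    refine ⟨_, ht, fun χ hχ => by simp [hχ], by simp, fun σ' ψ' he => ?_⟩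
    cases he
    exact .inr ⟨t, by simp⟩
  · exact ⟨φ.neg :: Γ, hn, List.subset_cons_self _ _, by simp, fun σ ψ he => (ha ⟨σ, ψ, he⟩).elim⟩

/-- Lindenbaum's construction along an enumeration of the formulas. Each stage is a finite
consistent list that decides one more formula and, if it rejects a universal one, also contains a
counterexample. Derivations use finitely many assumptions, so the union inherits consistency. -/
theorem Consistent.exists_henkin {T : Set Fml} {Γ : List Fml} (h : Consistent T Γ) :
    ∃ H : Henkin T, ∀ φ ∈ Γ, φ ∈ H.mem := by
  obtain ⟨e, he⟩ := exists_surjective_nat Fml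
  choose! next hc hsub hmem hwit using fun (Δ : List Fml) (hΔ : Consistent T Δ) => hΔ.step (T := T)
  let G : ℕ → List Fml := fun n => Nat.rec Γ (fun n Δ => next Δ (e n)) n
  have hG : ∀ n, Consistent T (G n) := fun n => by
    induction n with
    | zero => exact h
    | succ n ih => exact hc _ ih _
  have hmono : ∀ m n, m ≤ n → G m ⊆ G n := fun m n hmn => by
    induction n, hmn using Nat.le_induction with
    | base => exact List.Subset.refl _
    | succ n _ ih => exact fun χ hχ => hsub _ (hG n) (e n) (ih hχ)
  have hlist : ∀ Δ : List Fml, (∀ ψ ∈ Δ, ∃ n, ψ ∈ G n) → ∃ n, Δ ⊆ G n := fun Δ => by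
    induction Δ with
    | nil => exact fun _ => ⟨0, List.nil_subset _⟩
    | cons ψ Δ ih =>
      intro hΔ
      obtain ⟨m, hm⟩ := hΔ ψ (by simp)
      obtain ⟨n, hn⟩ := ih fun χ hχ => hΔ χ (by simp [hχ])
      refine ⟨max m n, fun χ hχ => ?_⟩
      rcases List.mem_cons.1 hχ with rfl | hχ
      · exact hmono _ _ (le_max_left _ _) hm
      · exact hmono _ _ (le_max_right _ _) (hn hχ)
  have hor : ∀ φ, (∃ n, φ ∈ G n) ∨ ∃ n, φ.neg ∈ G n := fun φ => by
    obtain ⟨n, rfl⟩ := he φ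
    exact (hmem _ (hG n) (e n)).imp (fun h => ⟨n + 1, h⟩) fun h => ⟨n + 1, h⟩
  have hbot : ∀ Δ : List Fml, (∀ ψ ∈ Δ, ∃ n, ψ ∈ G n) → ¬ Derives T Δ .bot := fun Δ hΔ hd => by
    obtain ⟨n, hn⟩ := hlist Δ hΔ
    exact hG n (hd.weaken hn)
  have hclosed : ∀ (Δ : List Fml) φ, (∀ ψ ∈ Δ, ∃ n, ψ ∈ G n) → Derives T Δ φ → ∃ n, φ ∈ G n := by
    intro Δ φ hΔ hd
    refine (hor φ).resolve_right fun hn => hbot (φ.neg :: Δ) ?_ ?_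
    · simpa using ⟨hn, hΔ⟩
    · exact .impE (.hyp (by simp [Fml.neg])) (hd.weaken (List.subset_cons_self _ _))
  refine ⟨⟨{φ | ∃ n, φ ∈ G n}, fun {Δ φ} => hclosed Δ φ, ?_, hor, ?_⟩, fun φ hφ => ⟨0, hφ⟩⟩
  · exact fun h => hbot [.bot] (by simpa using h) (.hyp (by simp))
  · intro σ φ hn
    obtain ⟨n, hn'⟩ := he (.all σ φ)
    -- At the stage that treats `.all σ φ`, either the formula was accepted, which contradicts its
    -- negation being in the union, or a counterexample was added.
    rcases hwit _ (hG n) (e n) σ φ hn' with hm | ⟨t, ht⟩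
    · refine (hbot [(Fml.all σ φ).neg, .all σ φ] ?_ (.impE (φ := .all σ φ)
        (.hyp (by simp [Fml.neg])) (.hyp (by simp)))).elim
      simpa using ⟨hn, n + 1, hn' ▸ hm⟩
    · exact ⟨t, n + 1, ht⟩

namespace Henkin

variable {T : Set Fml} (H : Henkin T)

theorem mem_of_proves {φ : Fml} (h : Derives T [] φ) : φ ∈ H.mem := H.closed (by simp) h

theorem mp {φ ψ : Fml} (h : (φ ⟹ ψ) ∈ H.mem) (h' : φ ∈ H.mem) : ψ ∈ H.mem :=
  H.closed (Γ := [φ ⟹ ψ, φ]) (by simpa using ⟨h, h'⟩) (.impE (φ := φ) (.hyp (by simp)) (.hyp (by simp)))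

theorem neg_mem {φ : Fml} : φ.neg ∈ H.mem ↔ φ ∉ H.mem :=
  ⟨fun h h' => H.bot_notMem (H.mp h h'), fun h => (H.mem_or_neg φ).resolve_left h⟩

theorem imp_mem {φ ψ : Fml} : (φ ⟹ ψ) ∈ H.mem ↔ (φ ∈ H.mem → ψ ∈ H.mem) := by
  refine ⟨H.mp, fun h => ?_⟩
  by_cases hφ : φ ∈ H.mem
  · exact H.closed (Γ := [ψ]) (by simpa using h hφ) (.impI (.hyp (by simp)))
  · refine H.closed (Γ := [φ.neg]) (by simpa using H.neg_mem.2 hφ) (.impI (.raa ?_))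
    exact .impE (φ := φ) (.hyp (by simp [Fml.neg])) (.hyp (by simp))

theorem all_mem {σ : Ty} {φ : Fml} : Fml.all σ φ ∈ H.mem ↔ ∀ t, φ.inst σ t ∈ H.mem := by
  refine ⟨fun h t => H.closed (Γ := [.all σ φ]) (by simpa using h) (.allE t (.hyp (by simp))),
    fun h => ?_⟩
  by_contra hn
  obtain ⟨t, ht⟩ := H.witness (H.neg_mem.2 hn)
  exact H.neg_mem.1 ht (h t)

theorem eq_refl (t : Tm Ty.nat) : Fml.eq t t ∈ H.mem := H.mem_of_proves (.eqRefl t)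

theorem eq_subst (φ : Fml) {s t : Tm Ty.nat} (h : Fml.eq s t ∈ H.mem) (h' : φ.inst .nat s ∈ H.mem) :
    φ.inst .nat t ∈ H.mem :=
  H.closed (Γ := [.eq s t, φ.inst .nat s]) (by simpa using ⟨h, h'⟩)
    (.eqSubst φ (s := s) (.hyp (by simp)) (.hyp (by simp)))

end Henkin

/-! ### Equality of numbers in a Henkin set -/

theorem Tm.up_inst (σ : Ty) (a : Tm σ) {τ : Ty} (t : Tm τ) :
    (t.up σ 1).subst (Sub.single σ a) = t := by
  rw [Sub.single_eq, Tm.up_subst_cons, Tm.subst_var]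

namespace Henkin

variable {T : Set Fml} (H : Henkin T)

theorem eq_symm {s t : Tm Ty.nat} (h : Fml.eq s t ∈ H.mem) : Fml.eq t s ∈ H.mem := by
  have := H.eq_subst (.eq (v 0) (s.up .nat 1)) h
  simp only [Fml.inst, Fml.subst, Tm.up_inst] at this
  exact this (H.eq_refl s)

theorem eq_trans {s t u : Tm Ty.nat} (h : Fml.eq s t ∈ H.mem) (h' : Fml.eq t u ∈ H.mem) :
    Fml.eq s u ∈ H.mem := by
  have := H.eq_subst (.eq (s.up .nat 1) (v 0)) h'
  simp only [Fml.inst, Fml.subst, Tm.up_inst] at this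
  exact this h

theorem lt_congr {s s' t t' : Tm Ty.nat} (h : Fml.eq s s' ∈ H.mem) (h' : Fml.eq t t' ∈ H.mem)
    (hl : Fml.lt s t ∈ H.mem) : Fml.lt s' t' ∈ H.mem := by
  have h₁ := H.eq_subst (.lt (v 0) (t.up .nat 1)) h
  have h₂ := H.eq_subst (.lt (s'.up .nat 1) (v 0)) h'
  simp only [Fml.inst, Fml.subst, Tm.up_inst] at h₁ h₂
  exact h₂ (h₁ hl)

end Henkin

/-! ### Equality at higher types as a congruence -/

theorem eqAt_subst (s : Sub) {τ : Ty} (t u : Tm τ) :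
    (eqAt τ t u).subst s = eqAt τ (t.subst s) (u.subst s) := by
  induction τ generalizing s with
  | nat => rfl
  | arr σ τ _ ih =>
    simp only [eqAt, Fml.subst, ih, Tm.subst, Tm.up_subst_under]
    simp [Sub.under_eq]

namespace Henkin

variable {T : Set Fml} (H : Henkin T)

/-- Provable equality of all values. -/
def Rel : {τ : Ty} → Tm τ → Tm τ → Prop
  | .nat, t, u => Fml.eq t u ∈ H.mem
  | .arr _ _, t, u => ∀ a, Rel (t ⋄ a) (u ⋄ a)

theorem eqAt_mem {τ : Ty} (t u : Tm τ) : eqAt τ t u ∈ H.mem ↔ H.Rel t u := by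
  induction τ with
  | nat => rfl
  | arr σ τ _ ih =>
    simp only [eqAt, H.all_mem, Rel, ← ih]
    refine forall_congr' fun a => ?_
    simp only [Fml.inst, eqAt_subst, Tm.subst, Tm.up_inst]
    simp [Sub.single_eq]

theorem Rel.refl {τ : Ty} (t : Tm τ) : H.Rel t t := by
  induction τ with
  | nat => exact H.eq_refl t
  | arr σ τ _ ih => exact fun a => ih _

theorem Rel.symm {τ : Ty} {t u : Tm τ} (h : H.Rel t u) : H.Rel u t := by
  induction τ with
  | nat => exact H.eq_symm h
  | arr σ τ _ ih => exact fun a => ih (h a)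

theorem Rel.trans {τ : Ty} {t u w : Tm τ} (h : H.Rel t u) (h' : H.Rel u w) : H.Rel t w := by
  induction τ with
  | nat => exact H.eq_trans h h'
  | arr σ τ _ ih => exact fun a => ih (h a) (h' a)

/-- Changing the function is immediate from the definition of `Rel` at arrow types; changing the
argument is an instance of the extensionality axiom. -/
theorem Rel.app (hT : ∀ ρ τ : Ty, (eqAt ρ (Tm.var ρ 0) (Tm.var ρ 1) ⟹
      eqAt τ (Tm.var (ρ ⇒ τ) 2 ⋄ Tm.var ρ 0) (Tm.var (ρ ⇒ τ) 2 ⋄ Tm.var ρ 1)) ∈ T)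
    {σ τ : Ty} {f g : Tm (σ ⇒ τ)} {t u : Tm σ} (h : H.Rel f g) (h' : H.Rel t u) :
    H.Rel (f ⋄ t) (g ⋄ u) := by
  refine (h t).trans H ?_
  have hne : (σ ⇒ τ) ≠ σ := fun he => by
    have := congrArg sizeOf he
    simp at this
    omega
  -- The inner assignment ignores the index, so `var (σ ⇒ τ) 2` receives `g`; `hne` ensures that the
  -- two entries of type `σ` do not interfere.
  let s : Sub := cons σ t (cons σ u fun κ _ => cons (σ ⇒ τ) g Tm.var κ 0)
  have := H.mem_of_proves ((Derives.ax (Γ := []) (hT σ τ)).subst_of_nil [] s)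
  simp only [Fml.subst, eqAt_subst, Tm.subst, H.imp_mem, eqAt_mem] at this
  simp only [s, cons_zero, cons_ne hne,
    show cons σ t (cons σ u fun κ _ => cons (σ ⇒ τ) g Tm.var κ 0) σ 1 = u from
      (cons_succ σ _ _ 0).trans (cons_zero _ _ _)] at this
  exact this h'

end Henkin

/-! ## Structures for the language -/

/-- A structure for the language of higher-order arithmetic. -/
structure PreModel where
  C : Ty → Type
  ap : {σ τ : Ty} → C (σ ⇒ τ) → C σ → C τ
  zero : C .nat
  one : C .nat
  add : C (.nat ⇒ .nat ⇒ .nat)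
  mul : C (.nat ⇒ .nat ⇒ .nat)
  combK (ρ τ : Ty) : C (ρ ⇒ τ ⇒ ρ)
  combS (ρ σ τ : Ty) : C ((ρ ⇒ σ ⇒ τ) ⇒ (ρ ⇒ σ) ⇒ ρ ⇒ τ)
  recursor (σ : Ty) : C ((Ty.nat ⇒ σ ⇒ σ) ⇒ σ ⇒ Ty.nat ⇒ σ)
  lt : C .nat → C .nat → Prop

namespace PreModel

variable (M : PreModel)

abbrev Val : Type := (τ : Ty) → ℕ → M.C τ

def eval (ρ : M.Val) : {τ : Ty} → Tm τ → M.C τ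
  | _, .var τ n => ρ τ n
  | _, .zero => M.zero
  | _, .one => M.one
  | _, .add => M.add
  | _, .mul => M.mul
  | _, .combK ρ τ => M.combK ρ τ
  | _, .combS ρ σ τ => M.combS ρ σ τ
  | _, .recursor σ => M.recursor σ
  | _, .app f t => M.ap (eval ρ f) (eval ρ t)

def Sat : M.Val → Fml → Prop
  | ρ, .eq t u => M.eval ρ t = M.eval ρ u
  | ρ, .lt t u => M.lt (M.eval ρ t) (M.eval ρ u)
  | _, .bot => False
  | ρ, .imp φ ψ => Sat ρ φ → Sat ρ ψ
  | ρ, .all σ φ => ∀ a : M.C σ, Sat (cons σ a ρ) φ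

end PreModel

/-- An extensional structure in which every object is named by a term with parameters `base`. -/
structure Model extends PreModel where
  ext {σ τ : Ty} {f g : C (σ ⇒ τ)} : (∀ a, ap f a = ap g a) → f = g
  base : toPreModel.Val
  named {τ : Ty} (a : C τ) : ∃ t : Tm τ, toPreModel.eval base t = a

namespace Henkin

variable {T : Set Fml} (H : Henkin T)

def setoid (τ : Ty) : Setoid (Tm τ) := ⟨H.Rel, Rel.refl H, Rel.symm H, Rel.trans H⟩

variable (hT : ∀ ρ τ : Ty, (eqAt ρ (Tm.var ρ 0) (Tm.var ρ 1) ⟹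
  eqAt τ (Tm.var (ρ ⇒ τ) 2 ⋄ Tm.var ρ 0) (Tm.var (ρ ⇒ τ) 2 ⋄ Tm.var ρ 1)) ∈ T)

/-- The structure of terms modulo provable equality. -/
def preModel : PreModel where
  C τ := Quotient (H.setoid τ)
  ap := Quotient.map₂ Tm.app fun _ _ hf _ _ ht => Rel.app H hT hf ht
  zero := Quotient.mk _ .zero
  one := Quotient.mk _ .one
  add := Quotient.mk _ .add
  mul := Quotient.mk _ .mul
  combK ρ τ := Quotient.mk _ (.combK ρ τ)
  combS ρ σ τ := Quotient.mk _ (.combS ρ σ τ)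
  recursor σ := Quotient.mk _ (.recursor σ)
  lt := Quotient.lift₂ (fun s t => Fml.lt s t ∈ H.mem) fun _ _ _ _ h h' =>
    propext ⟨H.lt_congr h h', H.lt_congr (H.eq_symm h) (H.eq_symm h')⟩

theorem eval_preModel (s : Sub) {τ : Ty} (t : Tm τ) :
    (H.preModel hT).eval (fun τ n => Quotient.mk (H.setoid τ) (s τ n)) t =
      Quotient.mk (H.setoid τ) (t.subst s) := by
  induction t with
  | app f t ihf iht =>
    change (H.preModel hT).ap _ _ = _
    rw [ihf, iht]
    rfl
  | _ => rfl

/-- The truth lemma. In the quantifier case every object is the class of a term, so the Henkin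
property `all_mem` covers all instances. -/
theorem sat_preModel (s : Sub) (φ : Fml) :
    (H.preModel hT).Sat (fun τ n => Quotient.mk (H.setoid τ) (s τ n)) φ ↔ φ.subst s ∈ H.mem := by
  induction φ generalizing s with
  | eq t u =>
    simp only [PreModel.Sat, eval_preModel, Fml.subst]
    exact Quotient.eq
  | lt t u =>
    simp only [PreModel.Sat, eval_preModel, Fml.subst]
    rfl
  | bot => simpa [PreModel.Sat, Fml.subst] using H.bot_notMem
  | imp φ ψ ihφ ihψ => simp only [PreModel.Sat, Fml.subst, ihφ, ihψ, H.imp_mem]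
  | all σ φ ih =>
    simp only [PreModel.Sat, Fml.subst, H.all_mem, Fml.under_inst, ← ih]
    have (t : Tm σ) : (fun τ n => Quotient.mk (H.setoid τ) (cons σ t s τ n)) =
        cons (C := (H.preModel hT).C) σ (Quotient.mk (H.setoid σ) t)
          (fun τ n => Quotient.mk (H.setoid τ) (s τ n)) := by
      funext τ n
      exact cons_map (D := (H.preModel hT).C) (fun τ t => Quotient.mk (H.setoid τ) t) σ t s τ n
    simp only [this]
    exact Quotient.forall

def model : Model where
  toPreModel := H.preModel hT
  ext {σ τ} f g := by
    induction f using Quotient.inductionOn with | _ f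
    induction g using Quotient.inductionOn with | _ g
    exact fun h => Quotient.sound fun a => Quotient.exact (h (Quotient.mk _ a))
  base τ n := Quotient.mk _ (.var τ n)
  named a := by
    induction a using Quotient.inductionOn with | _ t
    exact ⟨t, by rw [eval_preModel, Tm.subst_var]⟩

theorem sat_model {φ : Fml} (h : φ ∈ T) (ρ : (H.model hT).Val) : (H.model hT).Sat ρ φ := by
  obtain ⟨s, rfl⟩ : ∃ s : Sub, (fun τ n => Quotient.mk (H.setoid τ) (s τ n)) = ρ :=
    ⟨fun τ n => (ρ τ n).out, by funext τ n; exact Quotient.out_eq _⟩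
  exact (H.sat_preModel hT s φ).2 (H.mem_of_proves ((Derives.ax (Γ := []) h).subst_of_nil [] s))

end Henkin

/-- Completeness for theories that contain the axioms of extensionality. -/
theorem proves_of_models {T : Set Fml} (hT : ∀ ρ τ : Ty, (eqAt ρ (Tm.var ρ 0) (Tm.var ρ 1) ⟹
      eqAt τ (Tm.var (ρ ⇒ τ) 2 ⋄ Tm.var ρ 0) (Tm.var (ρ ⇒ τ) 2 ⋄ Tm.var ρ 1)) ∈ T) (φ : Fml)
    (h : ∀ M : Model, (∀ ψ ∈ T, ∀ ρ, M.Sat ρ ψ) → M.Sat M.base φ) : Proves T φ := by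
  by_contra hn
  have hc : Consistent T [φ.neg] := fun hd => hn (.raa hd)
  obtain ⟨H, hH⟩ := hc.exists_henkin
  have := (H.sat_preModel hT Tm.var φ).1 (h (H.model hT) fun ψ hψ ρ => H.sat_model hT hψ ρ)
  rw [Fml.subst_var] at this
  exact H.neg_mem.1 (hH _ (by simp)) this

/-! ## Satisfaction and substitution -/

/-- Forget the values at the first `k` variables of type `σ`. -/
def drop {C : Ty → Type*} (σ : Ty) (k : ℕ) (ρ : (τ : Ty) → ℕ → C τ) : (τ : Ty) → ℕ → C τ :=
  fun τ n => ρ τ (if τ = σ then n + k else n)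

section drop

variable {C : Ty → Type*}

@[simp] theorem drop_zero (σ : Ty) (ρ : (τ : Ty) → ℕ → C τ) : drop σ 0 ρ = ρ := by
  funext τ n
  simp [drop]

@[simp] theorem drop_succ_cons (σ : Ty) (k : ℕ) (a : C σ) (ρ : (τ : Ty) → ℕ → C τ) :
    drop σ (k + 1) (cons σ a ρ) = drop σ k ρ := by
  funext τ n
  by_cases h : τ = σ
  · subst h
    simp [drop, ← add_assoc]
  · simp [drop, h]

@[simp] theorem drop_cons {σ τ : Ty} (h : τ ≠ σ) (k : ℕ) (a : C τ) (ρ : (τ : Ty) → ℕ → C τ) :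
    drop σ k (cons τ a ρ) = cons τ a (drop σ k ρ) := by
  funext κ n
  by_cases h₁ : κ = τ
  · subst h₁
    cases n <;> simp [drop, h]
  · simp [drop, cons_ne h₁]

end drop

namespace PreModel

variable (M : PreModel) (ρ : M.Val)

theorem eval_subst (s : Sub) {τ : Ty} (t : Tm τ) :
    M.eval ρ (t.subst s) = M.eval (fun τ n => M.eval ρ (s τ n)) t := by
  induction t with
  | app f t ihf iht => simp only [Tm.subst, eval, ihf, iht]
  | _ => rfl

@[simp] theorem eval_up (σ : Ty) (k : ℕ) {τ : Ty} (t : Tm τ) :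
    M.eval ρ (t.up σ k) = M.eval (drop σ k ρ) t := by
  rw [Tm.up, eval_subst]
  rfl

theorem eval_under (σ : Ty) (s : Sub) (a : M.C σ) :
    (fun τ n => M.eval (cons σ a ρ) (s.under σ τ n)) =
      cons σ a (fun τ n => M.eval ρ (s τ n)) := by
  funext τ n
  rw [Sub.under_eq, cons_map (fun τ (t : Tm τ) => M.eval (cons σ a ρ) t)]
  simp [eval]

theorem sat_subst (s : Sub) (φ : Fml) :
    M.Sat ρ (φ.subst s) ↔ M.Sat (fun τ n => M.eval ρ (s τ n)) φ := by
  induction φ generalizing s ρ with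
  | eq t u => simp [Fml.subst, Sat, eval_subst]
  | lt t u => simp [Fml.subst, Sat, eval_subst]
  | bot => rfl
  | imp φ ψ ihφ ihψ => simp [Fml.subst, Sat, ihφ, ihψ]
  | all σ φ ih => simp [Fml.subst, Sat, ih, eval_under]

theorem sat_inst (σ : Ty) (t : Tm σ) (φ : Fml) :
    M.Sat ρ (φ.inst σ t) ↔ M.Sat (cons σ (M.eval ρ t) ρ) φ := by
  rw [Fml.inst, sat_subst, Sub.single_eq]
  have : (fun τ n => M.eval ρ (cons σ t Tm.var τ n)) = cons σ (M.eval ρ t) ρ := by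
    funext τ n
    rw [cons_map (fun τ (t : Tm τ) => M.eval ρ t)]
    rfl
  rw [this]

theorem sat_up (σ : Ty) (φ : Fml) : M.Sat ρ (φ.up σ) ↔ M.Sat (drop σ 1 ρ) φ := by
  rw [Fml.up, sat_subst]
  rfl

@[simp] theorem sat_eq (s t : Tm .nat) : M.Sat ρ (.eq s t) ↔ M.eval ρ s = M.eval ρ t := Iff.rfl
@[simp] theorem sat_lt (s t : Tm .nat) :
    M.Sat ρ (.lt s t) ↔ M.lt (M.eval ρ s) (M.eval ρ t) := Iff.rfl
@[simp] theorem sat_imp (φ ψ : Fml) : M.Sat ρ (φ ⟹ ψ) ↔ (M.Sat ρ φ → M.Sat ρ ψ) := Iff.rfl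
@[simp] theorem sat_all (σ : Ty) (φ : Fml) :
    M.Sat ρ (.all σ φ) ↔ ∀ a : M.C σ, M.Sat (cons σ a ρ) φ := Iff.rfl
@[simp] theorem sat_neg (φ : Fml) : M.Sat ρ φ.neg ↔ ¬ M.Sat ρ φ := Iff.rfl
@[simp] theorem sat_and (φ ψ : Fml) : M.Sat ρ (φ ⩓ ψ) ↔ M.Sat ρ φ ∧ M.Sat ρ ψ := by
  simp [Fml.and]
@[simp] theorem sat_or (φ ψ : Fml) : M.Sat ρ (φ ⩖ ψ) ↔ M.Sat ρ φ ∨ M.Sat ρ ψ := by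
  simp [Fml.or, or_iff_not_imp_left]
@[simp] theorem sat_iff (φ ψ : Fml) : M.Sat ρ (φ.iff ψ) ↔ (M.Sat ρ φ ↔ M.Sat ρ ψ) := by
  simp [Fml.iff, iff_def]
@[simp] theorem sat_ex (σ : Ty) (φ : Fml) :
    M.Sat ρ (.ex σ φ) ↔ ∃ a : M.C σ, M.Sat (cons σ a ρ) φ := by
  simp [Fml.ex]
@[simp] theorem sat_exNat_zero (φ : Fml) : M.Sat ρ (.exNat 0 φ) ↔ M.Sat ρ φ := Iff.rfl
@[simp] theorem sat_exNat_succ (k : ℕ) (φ : Fml) :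
    M.Sat ρ (.exNat (k + 1) φ) ↔ ∃ a : M.C .nat, M.Sat (cons .nat a ρ) (.exNat k φ) := by
  simp [Fml.exNat]

end PreModel

/-! ## Models of the theory -/

/-- A model of `RCA₀^ω + IND`. -/
structure ArithModel extends Model where
  sat {φ : Fml} : φ ∈ RCA0omega ∪ IND → ∀ ρ, toPreModel.Sat ρ φ

namespace ArithModel

variable (M : ArithModel)

/-- The numbers of the model. -/
abbrev N : Type := M.C .nat

variable {M}

instance : Zero M.N := ⟨M.zero⟩
instance : One M.N := ⟨M.one⟩
instance : Add M.N := ⟨fun a b => M.ap (M.ap M.add a) b⟩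
instance : Mul M.N := ⟨fun a b => M.ap (M.ap M.mul a) b⟩
instance : LT M.N := ⟨M.lt⟩
instance : LE M.N := ⟨fun a b => a < b ∨ a = b⟩

@[simp] theorem eval_zero (ρ : M.Val) : M.eval ρ (0 : Tm .nat) = (0 : M.N) := rfl
@[simp] theorem eval_one (ρ : M.Val) : M.eval ρ (1 : Tm .nat) = (1 : M.N) := rfl
@[simp] theorem eval_add (ρ : M.Val) (s t : Tm .nat) :
    M.eval ρ (s + t) = (M.eval ρ s + M.eval ρ t : M.N) := rfl
@[simp] theorem eval_mul (ρ : M.Val) (s t : Tm .nat) :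
    M.eval ρ (s * t) = (M.eval ρ s * M.eval ρ t : M.N) := rfl
@[simp] theorem eval_var (ρ : M.Val) (τ : Ty) (n : ℕ) : M.eval ρ (.var τ n) = ρ τ n := rfl
@[simp] theorem eval_app (ρ : M.Val) {σ τ : Ty} (f : Tm (σ ⇒ τ)) (t : Tm σ) :
    M.eval ρ (f ⋄ t) = M.ap (M.eval ρ f) (M.eval ρ t) := rfl
@[simp] theorem lt_eq (a b : M.N) : M.lt a b = (a < b) := rfl
theorem le_def {a b : M.N} : a ≤ b ↔ a < b ∨ a = b := Iff.rfl

@[simp] theorem sat_le (ρ : M.Val) (s t : Tm .nat) :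
    M.Sat ρ (.le s t) ↔ (M.eval ρ s : M.N) ≤ M.eval ρ t := by
  simp [Fml.le, le_def]

theorem sat_basic {φ : Fml} (h : φ ∈ basicAxioms) (ρ : M.Val) : M.Sat ρ φ :=
  M.sat (.inl (.basic h)) ρ

/-- The assignment of three numbers to the first number variables. -/
abbrev asg (a b c : M.N) : M.Val := cons .nat a (cons .nat b (cons .nat c M.base))

/-- Extensionality of the model turns the defined equality into genuine equality, so axioms stated
with `eqAt` become equations that can be rewritten with. -/
theorem sat_eqAt (ρ : M.Val) {τ : Ty} (t u : Tm τ) :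
    M.Sat ρ (eqAt τ t u) ↔ M.eval ρ t = M.eval ρ u := by
  induction τ generalizing ρ with
  | nat => rfl
  | arr σ τ _ ih =>
    simp only [eqAt, PreModel.sat_all, ih, eval_app, PreModel.eval_up, eval_var, cons_zero]
    simp only [drop_succ_cons σ 0, drop_zero]
    exact ⟨M.ext, fun h a => by rw [h]⟩

@[simp] theorem ap_combK {ρ τ : Ty} (a : M.C ρ) (b : M.C τ) :
    M.ap (M.ap (M.combK ρ τ) a) b = a := by
  have := (sat_eqAt (cons ρ a fun κ _ => cons τ b M.base κ 0) _ _).1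
    (M.sat (.inl (.combK ρ τ)) _)
  simp only [eval_app, eval_var, cons_zero] at this
  have h : cons (C := M.C) ρ a (fun κ _ => cons τ b M.base κ 0) τ 1 = b := by
    by_cases h : τ = ρ
    · subst h
      exact (cons_succ _ _ _ _).trans (cons_zero _ _ _)
    · rw [cons_ne h]
      simp
  rw [h] at this
  exact this

@[simp] theorem ap_combS {ρ σ τ : Ty} (f : M.C (ρ ⇒ σ ⇒ τ)) (g : M.C (ρ ⇒ σ)) (a : M.C ρ) :
    M.ap (M.ap (M.ap (M.combS ρ σ τ) f) g) a = M.ap (M.ap f a) (M.ap g a) := by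
  let e : M.Val := fun κ n =>
    match n with
    | 0 => cons (ρ ⇒ σ ⇒ τ) f M.base κ 0
    | 1 => cons (ρ ⇒ σ) g M.base κ 0
    | _ => cons ρ a M.base κ 0
  have := (sat_eqAt e _ _).1 (M.sat (.inl (.combS ρ σ τ)) _)
  simp only [eval_app, eval_var, e, cons_zero] at this
  exact this

/-! ### The numbers of a model as an ordered commutative semiring -/

protected theorem add_comm (a b : M.N) : a + b = b + a :=
  sat_basic (φ := .eq (v 0 + v 1) (v 1 + v 0)) (by simp [basicAxioms]) (asg a b 0)

protected theorem mul_comm (a b : M.N) : a * b = b * a :=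
  sat_basic (φ := .eq (v 0 * v 1) (v 1 * v 0)) (by simp [basicAxioms]) (asg a b 0)

protected theorem add_zero (a : M.N) : a + 0 = a := by
  have := sat_basic (φ := .eq (v 0 + 0) (v 0)) (by simp [basicAxioms]) (asg a 0 0)
  simpa only [PreModel.sat_eq, eval_add, eval_zero, eval_var, cons_zero] using this

protected theorem mul_one (a : M.N) : a * 1 = a := by
  have := sat_basic (φ := .eq (v 0 * 1) (v 0)) (by simp [basicAxioms]) (asg a 0 0)
  simpa only [PreModel.sat_eq, eval_mul, eval_one, eval_var, cons_zero] using this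

protected theorem mul_zero (a : M.N) : a * 0 = 0 := by
  have := sat_basic (φ := .eq (v 0 * 0) 0) (by simp [basicAxioms]) (asg a 0 0)
  simpa only [PreModel.sat_eq, eval_mul, eval_zero, eval_var, cons_zero] using this

protected theorem mul_add (a b c : M.N) : a * (b + c) = a * b + a * c :=
  sat_basic (φ := .eq (v 0 * (v 1 + v 2)) (v 0 * v 1 + v 0 * v 2)) (by simp [basicAxioms])
    (asg a b c)

instance : CommSemiring M.N where
  add_assoc a b c := sat_basic (φ := .eq (v 0 + v 1 + v 2) (v 0 + (v 1 + v 2)))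
    (by simp [basicAxioms]) (asg a b c)
  add_comm := ArithModel.add_comm
  add_zero := ArithModel.add_zero
  zero_add a := (ArithModel.add_comm 0 a).trans (ArithModel.add_zero a)
  nsmul := nsmulRec
  mul_assoc a b c := sat_basic (φ := .eq (v 0 * v 1 * v 2) (v 0 * (v 1 * v 2)))
    (by simp [basicAxioms]) (asg a b c)
  mul_comm := ArithModel.mul_comm
  mul_one := ArithModel.mul_one
  one_mul a := (ArithModel.mul_comm 1 a).trans (ArithModel.mul_one a)
  mul_zero := ArithModel.mul_zero
  zero_mul a := (ArithModel.mul_comm 0 a).trans (ArithModel.mul_zero a)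
  left_distrib := ArithModel.mul_add
  right_distrib a b c := by
    rw [ArithModel.mul_comm, ArithModel.mul_comm a, ArithModel.mul_comm b, ArithModel.mul_add]

protected theorem lt_irrefl (a : M.N) : ¬ a < a :=
  sat_basic (φ := .neg (.lt (v 0) (v 0))) (by simp [basicAxioms]) (asg a 0 0)

protected theorem lt_trans {a b c : M.N} : a < b → b < c → a < c :=
  sat_basic (φ := .lt (v 0) (v 1) ⟹ .lt (v 1) (v 2) ⟹ .lt (v 0) (v 2)) (by simp [basicAxioms])
    (asg a b c)

protected theorem lt_trichotomy (a b : M.N) : a < b ∨ a = b ∨ b < a := by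
  have := sat_basic (φ := .lt (v 0) (v 1) ⩖ .eq (v 0) (v 1) ⩖ .lt (v 1) (v 0))
    (by simp [basicAxioms]) (asg a b 0)
  simpa using this

noncomputable instance : LinearOrder M.N where
  le_refl a := .inr rfl
  le_trans a b c := by
    rintro (h | rfl) (h' | rfl)
    · exact .inl (ArithModel.lt_trans h h')
    · exact .inl h
    · exact .inl h'
    · exact .inr rfl
  lt_iff_le_not_ge a b := by
    refine ⟨fun h => ⟨.inl h, ?_⟩, ?_⟩
    · rintro (h' | rfl)
      · exact ArithModel.lt_irrefl _ (ArithModel.lt_trans h h')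
      · exact ArithModel.lt_irrefl _ h
    · rintro ⟨h | rfl, h'⟩
      · exact h
      · exact (h' (.inr rfl)).elim
  le_antisymm a b := by
    rintro (h | rfl) (h' | h')
    · exact (ArithModel.lt_irrefl _ (ArithModel.lt_trans h h')).elim
    · exact h'.symm
    all_goals rfl
  le_total a b := by
    rcases ArithModel.lt_trichotomy a b with h | rfl | h
    · exact .inl (.inl h)
    · exact .inl (.inr rfl)
    · exact .inr (.inl h)
  toDecidableLE := Classical.decRel _

theorem lt_add_one_iff {a b : M.N} : a < b + 1 ↔ a ≤ b := by
  have := sat_basic (φ := .iff (.lt (v 0) (v 1 + 1)) (.le (v 0) (v 1))) (by simp [basicAxioms])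
    (asg a b 0)
  simpa using this

theorem not_lt_zero (a : M.N) : ¬ a < 0 :=
  sat_basic (φ := .neg (.lt (v 0) 0)) (by simp [basicAxioms]) (asg a 0 0)

theorem zero_le (a : M.N) : 0 ≤ a := not_lt.1 (not_lt_zero a)

protected theorem add_lt_add_right {a b : M.N} (h : a < b) (c : M.N) : a + c < b + c :=
  sat_basic (φ := .lt (v 0) (v 1) ⟹ .lt (v 0 + v 2) (v 1 + v 2)) (by simp [basicAxioms])
    (asg a b c) h

protected theorem mul_lt_mul_right {a b c : M.N} (hc : 0 < c) (h : a < b) : a * c < b * c :=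
  sat_basic (φ := .lt 0 (v 2) ⟹ .lt (v 0) (v 1) ⟹ .lt (v 0 * v 2) (v 1 * v 2))
    (by simp [basicAxioms]) (asg a b c) hc h

instance : IsStrictOrderedRing M.N where
  add_le_add_left a b h c := by
    rcases h with h | rfl
    · exact (ArithModel.add_lt_add_right h c).le
    · exact le_rfl
  le_of_add_le_add_left a b c h := by
    by_contra hn
    have := ArithModel.add_lt_add_right (not_le.1 hn) a
    rw [add_comm c, add_comm b] at this
    exact this.not_ge h
  zero_le_one := zero_le 1
  exists_pair_ne := ⟨0, 1, fun h => by
    have : (0 : M.N) < 0 + 1 := lt_add_one_iff.2 le_rfl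
    rw [zero_add, ← h] at this
    exact lt_irrefl _ this⟩
  mul_lt_mul_of_pos_left c hc a b h := by
    have := ArithModel.mul_lt_mul_right hc h
    rwa [mul_comm a, mul_comm b] at this
  mul_lt_mul_of_pos_right c hc a b h := ArithModel.mul_lt_mul_right hc h

/-! ## Definability -/

/-- Tuples of objects as assignments to the variables. -/
class Ctx (M : ArithModel) (X : Type) where
  val : X → M.Val
  exists_lift {τ : Ty} (t : Tm τ) : ∃ t' : Tm τ, ∀ x, M.eval (val x) t' = M.eval M.base t

instance : Ctx M Unit where
  val _ := M.base
  exists_lift t := ⟨t, fun _ => rfl⟩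

instance {X : Type} [Ctx M X] {σ : Ty} : Ctx M (X × M.C σ) where
  val x := cons σ x.2 (Ctx.val x.1)
  exists_lift t := by
    obtain ⟨t', h⟩ := Ctx.exists_lift (M := M) (X := X) t
    refine ⟨t'.up σ 1, fun x => ?_⟩
    rw [PreModel.eval_up, drop_succ_cons σ 0, drop_zero, h]

variable {X : Type} [Ctx M X]

variable (M) in
/-- `f` is given by a term with parameters. -/
class DFun {X : Type} [Ctx M X] {τ : Ty} (f : X → M.C τ) : Prop where
  out : ∃ t : Tm τ, ∀ x, M.eval (Ctx.val x) t = f x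

variable (M) in
/-- `P` is given by a formula with parameters. -/
class DPred {X : Type} [Ctx M X] (P : X → Prop) : Prop where
  out : ∃ φ : Fml, ∀ x, M.Sat (Ctx.val x) φ ↔ P x

variable (M) in
/-- `P` is given by a quantifier-free formula with parameters. -/
class QPred {X : Type} [Ctx M X] (P : X → Prop) : Prop where
  out : ∃ φ : Fml, φ.QF ∧ ∀ x, M.Sat (Ctx.val x) φ ↔ P x

section closure

variable {Y Z W U : Type} [Ctx M Y] [Ctx M Z] [Ctx M W] [Ctx M U] {σ τ κ μ : Ty}

/-- This is where `named` is used: an arbitrary object of the model may appear as a parameter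
because a term denotes it. -/
instance DFun.const (a : M.C τ) : DFun M (fun _ : X => a) := by
  obtain ⟨t, rfl⟩ := M.named a
  exact ⟨Ctx.exists_lift t⟩

theorem DFun.comp_fst {f : X → M.C τ} (h : DFun M f) : DFun M (fun x : X × M.C σ => f x.1) := by
  obtain ⟨t, ht⟩ := h
  refine ⟨t.up σ 1, fun x => ?_⟩
  rw [← ht, PreModel.eval_up]
  exact congrArg (M.eval · t) ((drop_succ_cons σ 0 _ _).trans (drop_zero _ _))

instance DFun.snd : DFun M (fun x : X × M.C τ => x.2) :=
  ⟨Tm.var τ 0, fun x => cons_zero τ x.2 _⟩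

instance DFun.snd₁ : DFun M (fun x : (X × M.C τ) × M.C σ => x.1.2) := DFun.snd.comp_fst
instance DFun.snd₂ : DFun M (fun x : ((X × M.C τ) × M.C σ) × M.C κ => x.1.1.2) :=
  DFun.snd₁.comp_fst
instance DFun.snd₃ : DFun M (fun x : (((X × M.C τ) × M.C σ) × M.C κ) × M.C μ => x.1.1.1.2) :=
  DFun.snd₂.comp_fst
instance DFun.ap (f : X → M.C (σ ⇒ τ)) (g : X → M.C σ) [hf : DFun M f] [hg : DFun M g] :
    DFun M (fun x => M.ap (f x) (g x)) := by
  obtain ⟨t, ht⟩ := hf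
  obtain ⟨u, hu⟩ := hg
  exact ⟨t ⋄ u, fun x => by simp [ht, hu]⟩

instance DFun.add (f g : X → M.N) [DFun M f] [DFun M g] : DFun M (fun x => f x + g x) :=
  inferInstanceAs (DFun M (fun x => M.ap (M.ap M.add (f x)) (g x)))

instance DFun.mul (f g : X → M.N) [DFun M f] [DFun M g] : DFun M (fun x => f x * g x) :=
  inferInstanceAs (DFun M (fun x => M.ap (M.ap M.mul (f x)) (g x)))

instance QPred.eq (f g : X → M.N) [hf : DFun M f] [hg : DFun M g] :
    QPred M (fun x => f x = g x) := by
  obtain ⟨t, ht⟩ := hf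
  obtain ⟨u, hu⟩ := hg
  exact ⟨.eq t u, trivial, fun x => by simp [ht, hu]⟩

instance QPred.lt (f g : X → M.N) [hf : DFun M f] [hg : DFun M g] :
    QPred M (fun x => f x < g x) := by
  obtain ⟨t, ht⟩ := hf
  obtain ⟨u, hu⟩ := hg
  exact ⟨.lt t u, trivial, fun x => by simp [ht, hu]⟩

instance QPred.not (P : X → Prop) [hP : QPred M P] : QPred M (fun x => ¬ P x) := by
  obtain ⟨φ, hφ, h⟩ := hP
  exact ⟨φ.neg, ⟨hφ, trivial⟩, fun x => by simp [h]⟩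

instance QPred.and (P Q : X → Prop) [hP : QPred M P] [hQ : QPred M Q] :
    QPred M (fun x => P x ∧ Q x) := by
  obtain ⟨φ, hφ, h⟩ := hP
  obtain ⟨ψ, hψ, h'⟩ := hQ
  exact ⟨φ ⩓ ψ, ⟨⟨hφ, hψ, trivial⟩, trivial⟩, fun x => by simp [h, h']⟩

instance QPred.or (P Q : X → Prop) [hP : QPred M P] [hQ : QPred M Q] :
    QPred M (fun x => P x ∨ Q x) := by
  obtain ⟨φ, hφ, h⟩ := hP
  obtain ⟨ψ, hψ, h'⟩ := hQ
  exact ⟨φ ⩖ ψ, ⟨⟨hφ, trivial⟩, hψ⟩, fun x => by simp [h, h']⟩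

instance QPred.ne (f g : X → M.N) [DFun M f] [DFun M g] : QPred M (fun x => f x ≠ g x) :=
  inferInstanceAs (QPred M (fun x => ¬ f x = g x))

instance QPred.le (f g : X → M.N) [DFun M f] [DFun M g] : QPred M (fun x => f x ≤ g x) :=
  inferInstanceAs (QPred M (fun x => f x < g x ∨ f x = g x))

instance DPred.eq (f g : X → M.C τ) [hf : DFun M f] [hg : DFun M g] :
    DPred M (fun x => f x = g x) := by
  obtain ⟨t, ht⟩ := hf
  obtain ⟨u, hu⟩ := hg
  exact ⟨eqAt τ t u, fun x => by simp [sat_eqAt, ht, hu]⟩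

theorem QPred.dPred {P : X → Prop} (h : QPred M P) : DPred M P :=
  let ⟨φ, _, h⟩ := h.out
  ⟨φ, h⟩

instance DPred.lt (f g : X → M.N) [DFun M f] [DFun M g] : DPred M (fun x => f x < g x) :=
  (QPred.lt f g).dPred

instance DPred.imp (P Q : X → Prop) [hP : DPred M P] [hQ : DPred M Q] :
    DPred M (fun x => P x → Q x) := by
  obtain ⟨φ, h⟩ := hP
  obtain ⟨ψ, h'⟩ := hQ
  exact ⟨φ ⟹ ψ, fun x => by simp [h, h']⟩

instance DPred.not (P : X → Prop) [hP : DPred M P] : DPred M (fun x => ¬ P x) := by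
  obtain ⟨φ, h⟩ := hP
  exact ⟨φ.neg, fun x => by simp [h]⟩

instance DPred.ne (f g : X → M.C τ) [DFun M f] [DFun M g] : DPred M (fun x => f x ≠ g x) :=
  inferInstanceAs (DPred M (fun x => ¬ f x = g x))

instance DPred.and (P Q : X → Prop) [hP : DPred M P] [hQ : DPred M Q] :
    DPred M (fun x => P x ∧ Q x) := by
  obtain ⟨φ, h⟩ := hP
  obtain ⟨ψ, h'⟩ := hQ
  exact ⟨φ ⩓ ψ, fun x => by simp [h, h']⟩

instance DPred.or (P Q : X → Prop) [hP : DPred M P] [hQ : DPred M Q] :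
    DPred M (fun x => P x ∨ Q x) := by
  obtain ⟨φ, h⟩ := hP
  obtain ⟨ψ, h'⟩ := hQ
  exact ⟨φ ⩖ ψ, fun x => by simp [h, h']⟩

instance DPred.all (P : X → M.C σ → Prop) [hP : DPred M (fun x : X × M.C σ => P x.1 x.2)] :
    DPred M (fun x => ∀ a, P x a) := by
  obtain ⟨φ, h⟩ := hP
  exact ⟨.all σ φ, fun x => forall_congr' fun a => h (x, a)⟩

instance DPred.ex (P : X → M.C σ → Prop) [hP : DPred M (fun x : X × M.C σ => P x.1 x.2)] :
    DPred M (fun x => ∃ a, P x a) := by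
  obtain ⟨φ, h⟩ := hP
  exact ⟨.ex σ φ, fun x => (M.sat_ex _ _ _).trans (exists_congr fun a => h (x, a))⟩

end closure

/-! ## Induction, recursion, abstraction and choice -/

/-- Induction for definable predicates. -/
theorem induct (P : M.N → Prop) [hP : DPred M (fun x : Unit × M.N => P x.2)] (zero : P 0)
    (succ : ∀ n, P n → P (n + 1)) (n : M.N) : P n := by
  obtain ⟨φ, hφ⟩ := hP
  have h (n : M.N) : M.Sat (cons .nat n M.base) φ ↔ P n := hφ ((), n)
  have := M.sat (.inr ⟨φ, rfl⟩) M.base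
  simp only [induction, PreModel.sat_imp, PreModel.sat_all, PreModel.sat_inst, eval_zero, h,
    PreModel.sat_subst] at this
  refine this zero (fun n hn => ?_) n
  rw [← h] at hn
  convert (h (n + 1)).2 (succ n ((h n).1 hn)) using 1
  funext τ k
  cases τ with
  | nat => cases k <;> rfl
  | arr σ τ =>
    rw [cons_ne (by simp)]
    exact cons_ne (C := M.C) (σ := .nat) (τ := σ ⇒ τ) (by simp) n M.base k

theorem ap_recursor_zero (F : M.C (.nat ⇒ .nat ⇒ .nat)) (m : M.N) :
    M.ap (M.ap (M.ap (M.recursor .nat) F) m) (0 : M.N) = m :=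
  M.sat (.inl .recZero) (cons (.nat ⇒ .nat ⇒ .nat) F (cons .nat m M.base))

theorem ap_recursor_succ (F : M.C (.nat ⇒ .nat ⇒ .nat)) (m n : M.N) :
    M.ap (M.ap (M.ap (M.recursor .nat) F) m) (n + 1 : M.N) =
      M.ap (M.ap F n) (M.ap (M.ap (M.ap (M.recursor .nat) F) m) n) :=
  M.sat (.inl .recSucc) (cons (.nat ⇒ .nat ⇒ .nat) F (cons .nat m (cons .nat n M.base)))

theorem exists_rec (F : M.C (.nat ⇒ .nat ⇒ .nat)) (m : M.N) :
    ∃ g : M.C .one, M.ap g 0 = m ∧ ∀ n, M.ap g (n + 1) = M.ap (M.ap F n) (M.ap g n) :=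
  ⟨M.ap (M.ap (M.recursor .nat) F) m, ap_recursor_zero F m, ap_recursor_succ F m⟩

/-- Combinatory completeness. -/
theorem exists_abstract (M : ArithModel) (σ : Ty) {τ : Ty} (t : Tm τ) :
    ∃ u : Tm (σ ⇒ τ), ∀ (ρ : M.Val) a, M.ap (M.eval ρ u) a = M.eval (cons σ a ρ) t := by
  have hK {τ : Ty} (t : Tm τ) (h : ∀ (ρ : M.Val) (a : M.C σ), M.eval (cons σ a ρ) t = M.eval ρ t) :
      ∃ u : Tm (σ ⇒ τ), ∀ (ρ : M.Val) a, M.ap (M.eval ρ u) a = M.eval (cons σ a ρ) t :=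
    ⟨.combK τ σ ⋄ t, fun ρ a => by rw [h]; exact ap_combK _ _⟩
  induction t with
  | var τ n =>
    by_cases h : τ = σ
    · subst h
      cases n with
      | zero =>
        refine ⟨.combS τ (τ ⇒ τ) τ ⋄ .combK τ (τ ⇒ τ) ⋄ .combK τ τ, fun ρ a => ?_⟩
        rw [eval_var, cons_zero]
        exact (ap_combS _ _ _).trans (ap_combK _ _)
      | succ n =>
        refine ⟨.combK τ τ ⋄ .var τ n, fun ρ a => ?_⟩
        rw [eval_var, cons_succ]
        exact ap_combK _ _
    · exact hK _ fun ρ a => by simp [h]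
  | app f t ihf iht =>
    obtain ⟨u, hu⟩ := ihf
    obtain ⟨w, hw⟩ := iht
    refine ⟨.combS _ _ _ ⋄ u ⋄ w, fun ρ a => ?_⟩
    refine (ap_combS _ _ _).trans ?_
    rw [hu, hw, eval_app]
  | _ => exact hK _ fun ρ a => rfl

theorem DFun.exists_lam {X : Type} [Ctx M X] {σ τ : Ty} {f : X × M.C σ → M.C τ} (hf : DFun M f) :
    ∃ g : X → M.C (σ ⇒ τ), DFun M g ∧ ∀ x a, M.ap (g x) a = f (x, a) := by
  obtain ⟨t, ht⟩ := hf
  obtain ⟨u, hu⟩ := M.exists_abstract σ t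
  exact ⟨fun x => M.eval (Ctx.val x) u, ⟨u, fun _ => rfl⟩, fun x a => (hu _ a).trans (ht (x, a))⟩

theorem exists_lam {σ τ : Ty} (f : M.C σ → M.C τ) [hf : DFun M (fun x : Unit × M.C σ => f x.2)] :
    ∃ g : M.C (σ ⇒ τ), ∀ a, M.ap g a = f a := by
  obtain ⟨g, -, h⟩ := hf.exists_lam
  exact ⟨g (), fun a => h () a⟩

theorem exists_lam₂ {σ τ κ : Ty} (f : M.C σ → M.C τ → M.C κ)
    [hf : DFun M (fun x : (Unit × M.C σ) × M.C τ => f x.1.2 x.2)] :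
    ∃ g : M.C (σ ⇒ τ ⇒ κ), ∀ a b, M.ap (M.ap g a) b = f a b := by
  obtain ⟨g, hg, h⟩ := hf.exists_lam
  obtain ⟨g', -, h'⟩ := hg.exists_lam
  exact ⟨g' (), fun a b => by rw [h', h]⟩

theorem exists_choice (P : M.C .one → M.N → Prop)
    [hP : QPred M (fun x : (Unit × M.C .one) × M.N => P x.1.2 x.2)] (h : ∀ z, ∃ y, P z y) :
    ∃ f : M.C (.one ⇒ .nat), ∀ z, P z (M.ap f z) := by
  obtain ⟨φ, hQ, hφ⟩ := hP
  have hφ' (z : M.C .one) (y : M.N) : M.Sat (cons .nat y (cons .one z M.base)) φ ↔ P z y :=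
    hφ (((), z), y)
  have := M.sat (.inl (.qfAC hQ)) M.base
  simp only [choiceOneZero, PreModel.sat_imp, PreModel.sat_all, PreModel.sat_ex, hφ',
    PreModel.sat_inst, PreModel.sat_up] at this
  obtain ⟨f, hf⟩ := this h
  refine ⟨f, fun z => ?_⟩
  rw [← hφ']
  have := hf z
  rw [drop_cons (by simp), drop_cons (by simp), drop_succ_cons _ 0, drop_zero] at this
  exact this

/-- Choice for quantifier-free relations between numbers. -/
theorem exists_choice₂ (P : M.N → M.N → M.N → Prop)
    [hP : QPred M (fun x : (Unit × M.C .one) × M.N => P (M.ap x.1.2 0) (M.ap x.1.2 1) x.2)]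
    (h : ∀ n m, ∃ y, P n m y) :
    ∃ f : M.C (.nat ⇒ .nat ⇒ .nat), ∀ n m, P n m (M.ap (M.ap f n) m) := by
  -- The choice axiom takes an argument of type `1`, so the pair `n`, `m` is passed as a sequence
  -- whose first two values are `n` and `m`.
  obtain ⟨F, hF⟩ := exists_choice (fun z y => P (M.ap z 0) (M.ap z 1) y) (fun z => h _ _)
  -- Recursion with start `n` and constant step `m` gives such a sequence.
  obtain ⟨f, hf⟩ := exists_lam₂ (M := M) (fun n m : M.N => M.ap F
    (M.ap (M.ap (M.recursor .nat) (M.ap (M.combK (.nat ⇒ .nat) .nat)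
      (M.ap (M.combK .nat .nat) m))) n))
  refine ⟨f, fun n m => ?_⟩
  have := hF (M.ap (M.ap (M.recursor .nat) (M.ap (M.combK (.nat ⇒ .nat) .nat)
      (M.ap (M.combK .nat .nat) m))) n)
  rw [ap_recursor_zero] at this
  nth_rw 1 [← zero_add (1 : M.N)] at this
  rw [ap_recursor_succ, ap_combK, ap_combK] at this
  rwa [hf]

theorem exists_choice₁ (P : M.N → M.N → Prop)
    [hP : QPred M (fun x : (Unit × M.C .one) × M.N => P (M.ap x.1.2 0) x.2)]
    (h : ∀ n, ∃ y, P n y) : ∃ f : M.C .one, ∀ n, P n (M.ap f n) := by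
  obtain ⟨F, hF⟩ := exists_choice₂ (fun n _ y => P n y) (fun n _ => h n)
  obtain ⟨f, hf⟩ := exists_lam (M := M) (fun n : M.N => M.ap (M.ap F n) (0 : M.N))
  exact ⟨f, fun n => by rw [hf]; exact hF n 0⟩

end ArithModel

/-! ## The ordered field of fractions of an ordered semiring -/

section Diff

variable (N : Type) [CommSemiring N] [LinearOrder N] [IsStrictOrderedRing N]

/-- Pairs `(a, b)`, to be read as the difference `a - b`. -/
def diffSetoid : Setoid (N × N) where
  r p q := p.1 + q.2 = q.1 + p.2
  iseqv :=
    { refl := fun _ => rfl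
      symm := fun h => h.symm
      trans := fun {p q r} h h' => by
        refine add_right_cancel (b := q.1 + q.2) ?_
        calc p.1 + r.2 + (q.1 + q.2) = (p.1 + q.2) + (q.1 + r.2) := by ring
          _ = (q.1 + p.2) + (r.1 + q.2) := by rw [h, h']
          _ = r.1 + p.2 + (q.1 + q.2) := by ring }

/-- The ring of differences. -/
def Diff : Type := Quotient (diffSetoid N)

namespace Diff

variable {N}

def mk (a b : N) : Diff N := Quotient.mk (diffSetoid N) (a, b)

theorem mk_eq {a b c d : N} : mk a b = mk c d ↔ a + d = c + b := Quotient.eq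

theorem ind {P : Diff N → Prop} (h : ∀ a b, P (mk a b)) (x : Diff N) : P x :=
  Quotient.inductionOn x fun p => h p.1 p.2

instance : Zero (Diff N) := ⟨mk 0 0⟩
instance : One (Diff N) := ⟨mk 1 0⟩
instance : Add (Diff N) :=
  ⟨Quotient.map₂ (fun p q => (p.1 + q.1, p.2 + q.2)) fun p p' h q q' h' => by
    change p.1 + p'.2 = p'.1 + p.2 at h
    change q.1 + q'.2 = q'.1 + q.2 at h'
    change p.1 + q.1 + (p'.2 + q'.2) = p'.1 + q'.1 + (p.2 + q.2)
    rw [add_add_add_comm, h, h', add_add_add_comm]⟩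
instance : Neg (Diff N) :=
  ⟨Quotient.map (fun p => (p.2, p.1)) fun p p' h => by
    change p.1 + p'.2 = p'.1 + p.2 at h
    change p.2 + p'.1 = p'.2 + p.1
    rw [add_comm, ← h, add_comm]⟩
instance : Mul (Diff N) :=
  ⟨Quotient.map₂ (fun p q => (p.1 * q.1 + p.2 * q.2, p.1 * q.2 + p.2 * q.1))
    fun p p' h q q' h' => by
      change p.1 + p'.2 = p'.1 + p.2 at h
      change q.1 + q'.2 = q'.1 + q.2 at h'
      refine (diffSetoid N).trans (b := (p'.1 * q.1 + p'.2 * q.2, p'.1 * q.2 + p'.2 * q.1)) ?_ ?_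
      · change p.1 * q.1 + p.2 * q.2 + (p'.1 * q.2 + p'.2 * q.1) =
          p'.1 * q.1 + p'.2 * q.2 + (p.1 * q.2 + p.2 * q.1)
        calc _ = (p.1 + p'.2) * q.1 + (p'.1 + p.2) * q.2 := by ring
          _ = (p'.1 + p.2) * q.1 + (p.1 + p'.2) * q.2 := by rw [h]
          _ = _ := by ring
      · change p'.1 * q.1 + p'.2 * q.2 + (p'.1 * q'.2 + p'.2 * q'.1) =
          p'.1 * q'.1 + p'.2 * q'.2 + (p'.1 * q.2 + p'.2 * q.1)
        calc _ = p'.1 * (q.1 + q'.2) + p'.2 * (q'.1 + q.2) := by ring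
          _ = p'.1 * (q'.1 + q.2) + p'.2 * (q.1 + q'.2) := by rw [h']
          _ = _ := by ring⟩

theorem zero_def : (0 : Diff N) = mk 0 0 := rfl
theorem one_def : (1 : Diff N) = mk 1 0 := rfl
theorem mk_add (a b c d : N) : mk a b + mk c d = mk (a + c) (b + d) := rfl
theorem mk_mul (a b c d : N) : mk a b * mk c d = mk (a * c + b * d) (a * d + b * c) := rfl
theorem neg_mk (a b : N) : -mk a b = mk b a := rfl

instance : CommRing (Diff N) where
  add_assoc x y z := by
    induction x using ind; induction y using ind; induction z using ind
    simp only [mk_add, mk_eq]; ring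
  zero_add x := by
    induction x using ind
    simp only [zero_def, mk_add, mk_eq]; ring
  add_zero x := by
    induction x using ind
    simp only [zero_def, mk_add, mk_eq]; ring
  add_comm x y := by
    induction x using ind; induction y using ind
    simp only [mk_add, mk_eq]; ring
  nsmul := nsmulRec
  zsmul := zsmulRec
  neg_add_cancel x := by
    induction x using ind
    simp only [zero_def, neg_mk, mk_add, mk_eq]; ring
  mul_assoc x y z := by
    induction x using ind; induction y using ind; induction z using ind
    simp only [mk_mul, mk_eq]; ring
  mul_comm x y := by
    induction x using ind; induction y using ind
    simp only [mk_mul, mk_eq]; ring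
  one_mul x := by
    induction x using ind
    simp only [one_def, mk_mul, mk_eq]; ring
  mul_one x := by
    induction x using ind
    simp only [one_def, mk_mul, mk_eq]; ring
  zero_mul x := by
    induction x using ind
    simp only [zero_def, mk_mul, mk_eq]; ring
  mul_zero x := by
    induction x using ind
    simp only [zero_def, mk_mul, mk_eq]; ring
  left_distrib x y z := by
    induction x using ind; induction y using ind; induction z using ind
    simp only [mk_add, mk_mul, mk_eq]; ring
  right_distrib x y z := by
    induction x using ind; induction y using ind; induction z using ind
    simp only [mk_add, mk_mul, mk_eq]; ring

/-- The inclusion of the semiring in the ring of differences. -/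
def of : N →+* Diff N where
  toFun a := mk a 0
  map_zero' := rfl
  map_one' := rfl
  map_add' a b := by simp [mk_add]
  map_mul' a b := by simp [mk_mul]

theorem of_injective : Function.Injective (of (N := N)) := fun a b h => by
  simpa using mk_eq.1 h

theorem mk_eq_sub (a b : N) : mk a b = of a - of b := by
  rw [sub_eq_add_neg]
  change mk a b = mk (a + 0) (0 + b)
  simp

/-- The order is total and smaller elements can be subtracted, so a difference is a number up to
sign. Absence of zero divisors and the order on fractions both reduce to `N` in this way. -/
theorem exists_of_or_neg [ExistsAddOfLE N] (x : Diff N) :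
    (∃ a, x = of a) ∨ ∃ a, x = -of a := by
  induction x using ind with | _ a b
  rcases le_total b a with h | h
  · obtain ⟨c, rfl⟩ := exists_add_of_le h
    exact .inl ⟨c, by rw [mk_eq_sub, map_add]; ring⟩
  · obtain ⟨c, rfl⟩ := exists_add_of_le h
    exact .inr ⟨c, by rw [mk_eq_sub, map_add]; ring⟩

instance [ExistsAddOfLE N] : IsDomain (Diff N) := by
  have : Nontrivial (Diff N) :=
    ⟨⟨of 0, of 1, fun h => zero_ne_one (of_injective h)⟩⟩
  have : NoZeroDivisors (Diff N) := by
    refine ⟨fun {x y} h => ?_⟩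
    have key (a b : N) (h : of a * of b = 0) : of a = 0 ∨ of b = 0 := by
      rw [← map_mul, ← map_zero of] at h
      rcases mul_eq_zero.1 (of_injective h) with rfl | rfl <;> simp
    rcases exists_of_or_neg x with ⟨a, rfl⟩ | ⟨a, rfl⟩ <;>
      rcases exists_of_or_neg y with ⟨b, rfl⟩ | ⟨b, rfl⟩ <;>
      first
        | exact key a b h
        | (simp only [neg_mul, mul_neg, neg_eq_zero] at h ⊢; exact key a b h)
  exact NoZeroDivisors.to_isDomain _

end Diff

/-- The field of fractions. -/
abbrev Frac : Type := FractionRing (Diff N)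

namespace Frac

variable {N}

noncomputable def of : N →+* Frac N := (algebraMap (Diff N) (Frac N)).comp Diff.of

theorem of_injective : Function.Injective (of (N := N)) :=
  (IsFractionRing.injective (Diff N) (Frac N)).comp Diff.of_injective

variable [CanonicallyOrderedAdd N]

theorem exists_eq_div (x : Frac N) : ∃ a b : N, b ≠ 0 ∧ (x = of a / of b ∨ x = -(of a / of b)) := by
  obtain ⟨y, z, hz, rfl⟩ := IsFractionRing.div_surjective (A := Diff N) x
  have hz := nonZeroDivisors.ne_zero hz
  rcases Diff.exists_of_or_neg y with ⟨a, rfl⟩ | ⟨a, rfl⟩ <;>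
    rcases Diff.exists_of_or_neg z with ⟨b, rfl⟩ | ⟨b, rfl⟩ <;>
    refine ⟨a, b, fun h => hz (by simp [h]), ?_⟩
  · exact .inl rfl
  · exact .inr (by simp [of, div_neg])
  · exact .inr (by simp [of, neg_div])
  · exact .inl (by simp [of])

variable (N) in
/-- The nonnegative fractions. -/
noncomputable def cone : RingCone (Frac N) where
  carrier := {x | ∃ a b : N, b ≠ 0 ∧ x = of a / of b}
  zero_mem' := ⟨0, 1, one_ne_zero, by simp⟩
  one_mem' := ⟨1, 1, one_ne_zero, by simp⟩
  add_mem' := by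
    rintro _ _ ⟨a, b, hb, rfl⟩ ⟨c, d, hd, rfl⟩
    have hb' : of b ≠ 0 := fun h => hb (of_injective (by simpa using h))
    have hd' : of d ≠ 0 := fun h => hd (of_injective (by simpa using h))
    exact ⟨a * d + b * c, b * d, mul_ne_zero hb hd, by
      rw [div_add_div _ _ hb' hd']; simp only [map_add, map_mul]⟩
  mul_mem' := by
    rintro _ _ ⟨a, b, hb, rfl⟩ ⟨c, d, hd, rfl⟩
    exact ⟨a * c, b * d, mul_ne_zero hb hd, by rw [div_mul_div_comm]; simp only [map_mul]⟩
  eq_zero_of_mem_of_neg_mem' := by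
    rintro _ ⟨a, b, hb, rfl⟩ ⟨c, d, hd, h⟩
    have hb' : of b ≠ 0 := fun h => hb (of_injective (by simpa using h))
    have hd' : of d ≠ 0 := fun h => hd (of_injective (by simpa using h))
    have h₁ : of (a * d + c * b) = of 0 := by
      field_simp at h
      simp only [map_add, map_mul, map_zero]
      linear_combination -h
    -- A sum of elements of `N` that vanishes has vanishing summands, because the order is
    -- canonical.
    have h₂ : a * d = 0 := le_antisymm
      (le_self_add.trans (of_injective h₁).le) zero_le
    rcases mul_eq_zero.1 h₂ with rfl | rfl
    · simp
    · exact (hd rfl).elim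

instance : HasMemOrNegMem (cone N) := ⟨fun x => by
  obtain ⟨a, b, hb, rfl | rfl⟩ := exists_eq_div x
  · exact .inl ⟨a, b, hb, rfl⟩
  · exact .inr ⟨a, b, hb, by simp⟩⟩

open Classical in
noncomputable instance : LinearOrder (Frac N) := .mkOfAddGroupCone (cone N)

instance : IsStrictOrderedRing (Frac N) :=
  have : IsOrderedRing (Frac N) := .mkOfCone (cone N)
  IsOrderedRing.toIsStrictOrderedRing _

theorem nonneg_iff {x : Frac N} : 0 ≤ x ↔ ∃ a b : N, b ≠ 0 ∧ x = of a / of b := by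
  change x - 0 ∈ cone N ↔ _
  rw [sub_zero]
  exact Iff.rfl

theorem of_strictMono : StrictMono (of (N := N)) := by
  refine Monotone.strictMono_of_injective (fun a b h => ?_) of_injective
  obtain ⟨c, rfl⟩ := exists_add_of_le h
  rw [map_add]
  exact le_add_of_nonneg_right (nonneg_iff.2 ⟨c, 1, one_ne_zero, by simp⟩)

end Frac

end Diff

/-! ### Rationals, powers of two and codes in a model -/

namespace ArithModel

variable {M : ArithModel}

theorem add_one_le_iff {a b : M.N} : a + 1 ≤ b ↔ a < b := by
  rw [← not_lt, lt_add_one_iff, not_le]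

/-- The basic axioms do not assert that differences exist; induction on `b` supplies them. -/
theorem exists_add_eq (a b : M.N) (h : a ≤ b) : ∃ c, b = a + c := by
  revert h
  refine induct (fun b : M.N => a ≤ b → ∃ c, b = a + c) (fun h => ⟨0, ?_⟩) (fun n ih h => ?_) b
  · simp [le_antisymm h (zero_le a)]
  · rcases h with h | h
    · obtain ⟨c, hc⟩ := ih (lt_add_one_iff.1 h)
      exact ⟨c + 1, by rw [← add_assoc, ← hc]⟩
    · exact ⟨0, by simp [h]⟩

instance : ExistsAddOfLE M.N := ⟨fun {a b} h => exists_add_eq a b h⟩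

instance : CanonicallyOrderedAdd M.N where
  le_self_add _ b := le_add_of_nonneg_right (ArithModel.zero_le b)
  le_add_self _ b := le_add_of_nonneg_left (ArithModel.zero_le b)

variable (M) in
/-- The rationals of the model. -/
def Q : Type := Frac M.N

noncomputable instance : Field M.Q := inferInstanceAs (Field (Frac M.N))
noncomputable instance : LinearOrder M.Q := inferInstanceAs (LinearOrder (Frac M.N))
instance : IsStrictOrderedRing M.Q := inferInstanceAs (IsStrictOrderedRing (Frac M.N))

/-- The inclusion of the numbers in the rationals. -/
noncomputable def toQ : M.N →+* M.Q := Frac.of (N := M.N)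

theorem toQ_strictMono : StrictMono (toQ : M.N → M.Q) := Frac.of_strictMono

@[simp] theorem toQ_inj {a b : M.N} : toQ a = toQ b ↔ a = b := toQ_strictMono.injective.eq_iff
@[simp] theorem toQ_lt {a b : M.N} : toQ a < toQ b ↔ a < b := toQ_strictMono.lt_iff_lt
@[simp] theorem toQ_le {a b : M.N} : toQ a ≤ toQ b ↔ a ≤ b := toQ_strictMono.le_iff_le
theorem toQ_nonneg (a : M.N) : 0 ≤ toQ a := by
  rw [← map_zero (toQ (M := M)), toQ_le]
  exact ArithModel.zero_le a
theorem toQ_pos {a : M.N} : 0 < toQ a ↔ 0 < a := by rw [← map_zero (toQ (M := M)), toQ_lt]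

/-- The rationals have no infinitesimals relative to the numbers. -/
theorem exists_inv_le {x : M.Q} (hx : 0 < x) : ∃ b : M.N, 0 < b ∧ (toQ b)⁻¹ ≤ x := by
  obtain ⟨a, b, hb, rfl⟩ := Frac.nonneg_iff.1 hx.le
  change 0 < toQ a / toQ b at hx
  have hb' : 0 < toQ b := toQ_pos.2 (pos_iff_ne_zero.2 hb)
  have ha : 0 < a := toQ_pos.1 ((div_pos_iff_of_pos_right hb').1 hx)
  have ha' : toQ (0 + 1) ≤ toQ a := toQ_le.2 (add_one_le_iff.2 ha)
  refine ⟨b, toQ_pos.1 hb', ?_⟩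
  change _ ≤ toQ a / toQ b
  rw [inv_eq_one_div]
  gcongr
  simpa using ha'

infixl:90 " ⬝ " => PreModel.ap _

variable {X : Type} [Ctx M X]

/-! ## Powers of two -/

/-- `2ⁿ` -/
def pw (n : M.N) : M.N :=
  M.recursor .nat ⬝ (M.combK .one .nat ⬝ (M.combS .nat .nat .nat ⬝ M.add ⬝
    (M.combS .nat .one .nat ⬝ M.combK .nat .one ⬝ M.combK .nat .nat))) ⬝ (1 : M.N) ⬝ n

@[simp] theorem eval_pow2 (ρ : M.Val) (n : Tm .nat) : M.eval ρ (pow2 n) = pw (M.eval ρ n : M.N) := rfl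

instance DFun.pw (f : X → M.N) [DFun M f] : DFun M (fun x => pw (f x)) := by
  unfold ArithModel.pw
  infer_instance

@[simp] theorem pw_zero : pw (0 : M.N) = 1 := ap_recursor_zero _ _

theorem pw_succ (n : M.N) : pw (n + 1) = pw n + pw n := by
  rw [pw, ap_recursor_succ, ap_combK, ap_combS, ap_combS, ap_combK]
  rfl

@[simp] theorem pw_pos (n : M.N) : 0 < pw n := by
  refine induct (fun n : M.N => 0 < pw n) (by simp) (fun n ih => ?_) n
  rw [pw_succ]
  exact add_pos ih ih

theorem lt_pw (n : M.N) : n < pw n := by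
  refine induct (fun n : M.N => n < pw n) (by simp) (fun n ih => ?_) n
  rw [pw_succ]
  exact add_lt_add_of_lt_of_le ih (by simpa using add_one_le_iff.2 (pw_pos n))

theorem pw_add (m n : M.N) : pw (m + n) = pw m * pw n := by
  refine induct (fun n : M.N => pw (m + n) = pw m * pw n) (by simp) (fun n ih => ?_) n
  rw [← add_assoc, pw_succ, ih, pw_succ, mul_add]

/-! ## Codes of rationals -/

/-- `c` is the code of the fraction `(p - q) / (d + 1)`. -/
def IsFrac (c p q d : M.N) : Prop :=
  ∃ a, c + c = (a + d) * (a + d + 1) + (a + a) ∧ (a = p + p ∧ q = 0 ∨ a + 1 = q + q ∧ p = 0)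

@[simp] theorem sat_frac (ρ : M.Val) (c p q d : Tm .nat) :
    M.Sat ρ (frac c p q d) ↔
      IsFrac (M.eval ρ c : M.N) (M.eval ρ p) (M.eval ρ q) (M.eval ρ d) := by
  simp [frac, IsFrac]

/-- The gap between `s (s + 1)` and `(s + 1) (s + 2)` is `2 s + 2`, which exceeds `2 a`. Hence the
diagonals of the Cantor pairing do not overlap and the code determines `a + d`. -/
theorem mul_self_add_one_lt {s t : M.N} (h : s < t) (a : M.N) (ha : a ≤ s) :
    s * (s + 1) + (a + a) < t * (t + 1) := by
  have h₁ := add_one_le_iff.2 h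
  calc s * (s + 1) + (a + a) ≤ s * (s + 1) + (s + s) := by gcongr
    _ < s * (s + 1) + (s + s) + 1 + 1 := by
        rw [lt_add_one_iff]
        exact le_self_add
    _ = (s + 1) * (s + 1 + 1) := by ring
    _ ≤ t * (t + 1) := by gcongr

theorem pair_inj {a d a' d' : M.N}
    (h : (a + d) * (a + d + 1) + (a + a) = (a' + d') * (a' + d' + 1) + (a' + a')) :
    a = a' ∧ d = d' := by
  have hs : a + d = a' + d' := by
    rcases lt_trichotomy (a + d) (a' + d') with hl | he | hl
    · exact absurd h ((mul_self_add_one_lt hl a le_self_add).trans_le le_self_add).ne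
    · exact he
    · exact absurd h ((mul_self_add_one_lt hl a' le_self_add).trans_le le_self_add).ne'
  have ha : a = a' := by
    rw [hs] at h
    have h' := add_left_cancel h
    rcases lt_trichotomy a a' with hl | he | hl
    · exact absurd h' (add_lt_add hl hl).ne
    · exact he
    · exact absurd h' (add_lt_add hl hl).ne'
  exact ⟨ha, by rw [ha] at hs; exact add_left_cancel hs⟩

theorem add_self_inj {a b : M.N} (h : a + a = b + b) : a = b := by
  rcases lt_trichotomy a b with hl | he | hl
  · exact absurd h (add_lt_add hl hl).ne
  · exact he
  · exact absurd h (add_lt_add hl hl).ne'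

theorem add_self_ne (a b : M.N) : a + a + 1 ≠ b + b := by
  intro h
  rcases le_or_gt b a with hl | hl
  · have := add_le_add hl hl
    rw [← h, ← not_lt] at this
    exact this (lt_add_one_iff.2 le_rfl)
  · have h₁ := add_one_le_iff.2 hl
    have := add_le_add h₁ h₁
    rw [← h, ← not_lt] at this
    exact this (by rw [show a + 1 + (a + 1) = a + a + 1 + 1 by ring]; exact lt_add_one_iff.2 le_rfl)

theorem IsFrac.inj {c p q d p' q' d' : M.N} (h : IsFrac c p q d) (h' : IsFrac c p' q' d') :
    p = p' ∧ q = q' ∧ d = d' := by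
  obtain ⟨a, ha, h⟩ := h
  obtain ⟨b, hb, h'⟩ := h'
  obtain ⟨rfl, rfl⟩ := pair_inj (ha.symm.trans hb)
  rcases h with ⟨h₁, rfl⟩ | ⟨h₁, rfl⟩ <;> rcases h' with ⟨h₂, rfl⟩ | ⟨h₂, rfl⟩
  · exact ⟨add_self_inj (h₁.symm.trans h₂), rfl, rfl⟩
  · exact absurd (h₁ ▸ h₂) (add_self_ne _ _)
  · exact absurd (h₂ ▸ h₁) (add_self_ne _ _)
  · exact ⟨rfl, add_self_inj (h₁.symm.trans h₂), rfl⟩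

theorem even_or_odd (a : M.N) : (∃ h, a = h + h) ∨ ∃ h, a = h + h + 1 := by
  refine induct (fun a : M.N => (∃ h, a = h + h) ∨ ∃ h, a = h + h + 1) ?_ (fun n ih => ?_) a
  · exact .inl ⟨0, by simp⟩
  · rcases ih with ⟨h, rfl⟩ | ⟨h, rfl⟩
    · exact .inr ⟨h, rfl⟩
    · exact .inl ⟨h + 1, by ring⟩

theorem eq_zero_or_succ (a : M.N) : a = 0 ∨ ∃ b, a = b + 1 :=
  induct (fun a : M.N => a = 0 ∨ ∃ b, a = b + 1) (.inl rfl) (fun n _ => .inr ⟨n, rfl⟩) a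

theorem exists_pair (c : M.N) : ∃ a d, c + c = (a + d) * (a + d + 1) + (a + a) := by
  refine induct (fun c : M.N => ∃ a d, c + c = (a + d) * (a + d + 1) + (a + a)) ?_
    (fun n ih => ?_) c
  · exact ⟨0, 0, by simp⟩
  · obtain ⟨a, d, h⟩ := ih
    rw [show n + 1 + (n + 1) = n + n + 1 + 1 by ring, h]
    -- The successor of a code moves one place along the diagonal, or from its end `d = 0` to the
    -- start of the next diagonal.
    rcases eq_zero_or_succ d with rfl | ⟨b, rfl⟩
    · exact ⟨0, a + 1, by ring⟩
    · exact ⟨a + 1, b, by ring⟩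

theorem exists_isFrac (c : M.N) : ∃ p q d, IsFrac c p q d := by
  obtain ⟨a, d, h⟩ := exists_pair c
  rcases even_or_odd a with ⟨p, hp⟩ | ⟨q, hq⟩
  · exact ⟨p, 0, d, a, h, .inl ⟨hp, rfl⟩⟩
  · exact ⟨0, q + 1, d, a, h, .inr ⟨by rw [hq]; ring, rfl⟩⟩

theorem even_mul_succ (a : M.N) : ∃ b, a * (a + 1) = b + b := by
  rcases even_or_odd a with ⟨b, rfl⟩ | ⟨b, rfl⟩
  · exact ⟨b * (b + b + 1), by ring⟩
  · exact ⟨(b + b + 1) * (b + 1), by ring⟩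

theorem exists_code (p d : M.N) : ∃ c, IsFrac c p 0 d := by
  obtain ⟨b, hb⟩ := even_mul_succ (p + p + d)
  exact ⟨b + (p + p), p + p, by rw [hb]; ring, .inl ⟨rfl, rfl⟩⟩

theorem exists_rat (c : M.N) :
    ∃ r : M.Q, ∀ p q d, IsFrac c p q d → r = (toQ p - toQ q) / (toQ d + 1) := by
  obtain ⟨p, q, d, h⟩ := exists_isFrac c
  refine ⟨(toQ p - toQ q) / (toQ d + 1), fun p' q' d' h' => ?_⟩
  obtain ⟨rfl, rfl, rfl⟩ := h.inj h'
  rfl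

/-- The rational coded by `c`. -/
noncomputable def rat (c : M.N) : M.Q := (exists_rat c).choose

theorem IsFrac.rat_eq {c p q d : M.N} (h : IsFrac c p q d) :
    rat c = (toQ p - toQ q) / (toQ d + 1) :=
  (exists_rat c).choose_spec p q d h

theorem toQ_add_one_pos (d : M.N) : 0 < toQ d + 1 := add_pos_of_nonneg_of_pos (toQ_nonneg d) one_pos

theorem toQ_pw_pos (n : M.N) : 0 < toQ (pw n) := toQ_pos.2 (pw_pos n)

/-- `2⁻ⁿ` -/
noncomputable def tw (n : M.N) : M.Q := (toQ (pw n))⁻¹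

theorem tw_pos (n : M.N) : 0 < tw n := inv_pos.2 (toQ_pw_pos n)

/-- Clearing denominators is a positive scaling, and moving the negative parts across is a
translation. Invariance of `R` under both is all that is needed, which treats `<` and `≤` together.
-/
theorem sat_qCmp {cmp : Tm .nat → Tm .nat → Fml} (R : M.Q → M.Q → Prop)
    (hcmp : ∀ (ρ : M.Val) s t, M.Sat ρ (cmp s t) ↔ R (toQ (M.eval ρ s)) (toQ (M.eval ρ t)))
    (hR : ∀ a b c : M.Q, 0 < c → (R (a * c) (b * c) ↔ R a b))
    (hR' : ∀ a b c : M.Q, R (a + c) (b + c) ↔ R a b) (ρ : M.Val)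
    (r s k n : Tm .nat) :
    M.Sat ρ (qCmp cmp r s k n) ↔ R (rat (M.eval ρ r : M.N))
      (rat (M.eval ρ s : M.N) + toQ (M.eval ρ k) * tw (M.eval ρ n)) := by
  have key (p q d p' q' d' k n : M.N) :
      R (toQ (p * (d' + 1) * pw n + q' * (d + 1) * pw n))
        (toQ (p' * (d + 1) * pw n + q * (d' + 1) * pw n + k * (d + 1) * (d' + 1))) ↔
      R ((toQ p - toQ q) / (toQ d + 1))
        ((toQ p' - toQ q') / (toQ d' + 1) + toQ k * tw n) := by
    have h₁ := toQ_add_one_pos d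
    have h₂ := toQ_add_one_pos d'
    have h₃ := toQ_pw_pos n
    have hc := mul_pos (mul_pos h₁ h₂) h₃
    have e₁ : toQ (p * (d' + 1) * pw n + q' * (d + 1) * pw n) =
        (toQ p - toQ q) / (toQ d + 1) * ((toQ d + 1) * (toQ d' + 1) * toQ (pw n)) +
          toQ (q * (d' + 1) * pw n + q' * (d + 1) * pw n) := by
      simp only [map_add, map_mul, map_one]
      field_simp
      ring
    have e₂ : toQ (p' * (d + 1) * pw n + q * (d' + 1) * pw n + k * (d + 1) * (d' + 1)) =
        ((toQ p' - toQ q') / (toQ d' + 1) + toQ k * tw n) *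
          ((toQ d + 1) * (toQ d' + 1) * toQ (pw n)) +
          toQ (q * (d' + 1) * pw n + q' * (d + 1) * pw n) := by
      simp only [map_add, map_mul, map_one, tw]
      field_simp
      ring
    rw [e₁, e₂, hR', hR _ _ _ hc]
  simp only [qCmp, PreModel.sat_exNat_succ, PreModel.sat_exNat_zero, PreModel.sat_and, sat_frac,
    PreModel.eval_up, drop_succ_cons, drop_zero, hcmp, eval_add, eval_mul, eval_one, eval_pow2,
    eval_var, cons_zero, cons_succ, key]
  constructor
  · rintro ⟨p, q, d, p', q', d', h₁, h₂, h⟩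
    rwa [h₁.rat_eq, h₂.rat_eq]
  · intro h
    obtain ⟨p, q, d, h₁⟩ := exists_isFrac (M.eval ρ r : M.N)
    obtain ⟨p', q', d', h₂⟩ := exists_isFrac (M.eval ρ s : M.N)
    rw [h₁.rat_eq, h₂.rat_eq] at h
    exact ⟨p, q, d, p', q', d', h₁, h₂, h⟩

@[simp] theorem sat_qLt (ρ : M.Val) (r s k n : Tm .nat) :
    M.Sat ρ (qLt r s k n) ↔ rat (M.eval ρ r : M.N) <
      rat (M.eval ρ s : M.N) + toQ (M.eval ρ k) * tw (M.eval ρ n) :=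
  sat_qCmp (· < ·) (fun ρ s t => by simp) (fun a b c hc => mul_lt_mul_iff_left₀ hc)
    (fun a b c => add_lt_add_iff_right c) ρ r s k n

@[simp] theorem sat_qLe (ρ : M.Val) (r s k n : Tm .nat) :
    M.Sat ρ (qLe r s k n) ↔ rat (M.eval ρ r : M.N) ≤
      rat (M.eval ρ s : M.N) + toQ (M.eval ρ k) * tw (M.eval ρ n) :=
  sat_qCmp (· ≤ ·) (fun ρ s t => by simp) (fun a b c hc => mul_le_mul_iff_left₀ hc)
    (fun a b c => add_le_add_iff_right c) ρ r s k n

@[simp] theorem sat_qAdd (ρ : M.Val) (r s u : Tm .nat) :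
    M.Sat ρ (qAdd r s u) ↔ rat (M.eval ρ u : M.N) = rat (M.eval ρ r : M.N) + rat (M.eval ρ s : M.N) := by
  have key (p q d p' q' d' p'' q'' d'' : M.N) :
      ((p * (d' + 1) + p' * (d + 1)) * (d'' + 1) + q'' * (d + 1) * (d' + 1) =
        p'' * (d + 1) * (d' + 1) + (q * (d' + 1) + q' * (d + 1)) * (d'' + 1)) ↔
      (toQ p'' - toQ q'') / (toQ d'' + 1) =
        (toQ p - toQ q) / (toQ d + 1) + (toQ p' - toQ q') / (toQ d' + 1) := by
    have h₁ := toQ_add_one_pos d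
    have h₂ := toQ_add_one_pos d'
    have h₃ := toQ_add_one_pos d''
    rw [div_add_div _ _ h₁.ne' h₂.ne', div_eq_div_iff h₃.ne' (mul_pos h₁ h₂).ne', ← toQ_inj]
    simp only [map_add, map_mul, map_one]
    constructor <;> intro h <;> linear_combination -h
  simp only [qAdd, PreModel.sat_exNat_succ, PreModel.sat_exNat_zero, PreModel.sat_and, sat_frac,
    PreModel.eval_up, drop_succ_cons, drop_zero, PreModel.sat_eq, eval_add, eval_mul, eval_one,
    eval_var, cons_zero, cons_succ, key]
  constructor
  · rintro ⟨p, q, d, p', q', d', p'', q'', d'', h₁, h₂, h₃, h⟩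
    rwa [h₁.rat_eq, h₂.rat_eq, h₃.rat_eq]
  · intro h
    obtain ⟨p, q, d, h₁⟩ := exists_isFrac (M.eval ρ r : M.N)
    obtain ⟨p', q', d', h₂⟩ := exists_isFrac (M.eval ρ s : M.N)
    obtain ⟨p'', q'', d'', h₃⟩ := exists_isFrac (M.eval ρ u : M.N)
    rw [h₁.rat_eq, h₂.rat_eq, h₃.rat_eq] at h
    exact ⟨p, q, d, p', q', d', p'', q'', d'', h₁, h₂, h₃, h⟩

/-- `u` is the code of the absolute value of the rational coded by `r`. -/
def IsAbs (r u : M.N) : Prop := ∃ p q d, IsFrac r p q d ∧ IsFrac u (p + q) 0 d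

@[simp] theorem sat_qAbs (ρ : M.Val) (r u : Tm .nat) :
    M.Sat ρ (qAbs r u) ↔ IsAbs (M.eval ρ r : M.N) (M.eval ρ u) := by
  simp only [qAbs, PreModel.sat_exNat_succ, PreModel.sat_exNat_zero, PreModel.sat_and, sat_frac,
    PreModel.eval_up, drop_succ_cons, drop_zero, eval_add, eval_zero,
    eval_var, cons_zero, cons_succ, IsAbs]

theorem exists_isAbs (r : M.N) : ∃ u, IsAbs r u := by
  obtain ⟨p, q, d, h⟩ := exists_isFrac r
  obtain ⟨u, hu⟩ := exists_code (p + q) d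
  exact ⟨u, p, q, d, h, hu⟩

theorem IsAbs.rat_eq {r u : M.N} (h : IsAbs r u) : rat u = |rat r| := by
  obtain ⟨p, q, d, hr, hu⟩ := h
  rw [hr.rat_eq, hu.rat_eq, abs_div, abs_of_pos (toQ_add_one_pos d)]
  obtain ⟨a, -, ⟨-, rfl⟩ | ⟨-, rfl⟩⟩ := hr
  · simp [abs_of_nonneg (toQ_nonneg p)]
  · simp [abs_of_nonneg (toQ_nonneg q)]

/-! ## Reals -/

def IsReal (x : M.C .one) : Prop :=
  ∀ n i, rat (x ⬝ n) < rat (x ⬝ (n + i)) + tw n ∧ rat (x ⬝ (n + i)) < rat (x ⬝ n) + tw n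

def LeR (x y : M.C .one) : Prop := ∀ n, rat (x ⬝ n) ≤ rat (y ⬝ n) + 2 * tw n

def EqR (x y : M.C .one) : Prop := LeR x y ∧ LeR y x

/-- The real whose approximations all have the code `c`. -/
def constR (c : M.N) : M.C .one := M.combK .nat .nat ⬝ c

@[simp] theorem ap_constR (c n : M.N) : constR c ⬝ n = c := ap_combK _ _

theorem rat_zero : rat (0 : M.N) = 0 := by
  have : IsFrac (0 : M.N) 0 0 0 := ⟨0, by simp, .inl ⟨by simp, rfl⟩⟩
  rw [this.rat_eq]
  simp

theorem rat_five : rat (1 + 1 + 1 + 1 + 1 : M.N) = 1 := by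
  have : IsFrac (1 + 1 + 1 + 1 + 1 : M.N) 1 0 0 := ⟨1 + 1, by ring, .inl ⟨rfl, rfl⟩⟩
  rw [this.rat_eq]
  simp

def InUnit (x : M.C .one) : Prop :=
  IsReal x ∧ (∀ n, 0 ≤ rat (x ⬝ n) + 2 * tw n) ∧ ∀ n, rat (x ⬝ n) ≤ 1 + 2 * tw n

@[simp] theorem eval_zeroR (ρ : M.Val) : M.eval ρ zeroR = constR (0 : M.N) := rfl
@[simp] theorem eval_oneR (ρ : M.Val) : M.eval ρ oneR = constR (1 + 1 + 1 + 1 + 1 : M.N) := rfl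

@[simp] theorem sat_isReal (ρ : M.Val) (x : Tm .one) :
    M.Sat ρ (isReal x) ↔ IsReal (M.eval ρ x : M.C .one) := by
  simp [isReal, IsReal]

@[simp] theorem sat_leR (ρ : M.Val) (x y : Tm .one) :
    M.Sat ρ (leR x y) ↔ LeR (M.eval ρ x : M.C .one) (M.eval ρ y) := by
  simp [leR, LeR, one_add_one_eq_two, map_ofNat]

@[simp] theorem sat_eqR (ρ : M.Val) (x y : Tm .one) :
    M.Sat ρ (eqR x y) ↔ EqR (M.eval ρ x : M.C .one) (M.eval ρ y) := by
  simp [eqR, EqR]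

@[simp] theorem sat_inUnit (ρ : M.Val) (x : Tm .one) :
    M.Sat ρ (inUnit x) ↔ InUnit (M.eval ρ x : M.C .one) := by
  simp [inUnit, InUnit, LeR, rat_zero, rat_five]

instance DPred.eqR (f g : X → M.C .one) [hf : DFun M f] [hg : DFun M g] :
    DPred M (fun x => EqR (f x) (g x)) := by
  obtain ⟨t, ht⟩ := hf
  obtain ⟨u, hu⟩ := hg
  exact ⟨HOA.eqR t u, fun x => by simp [ht, hu]⟩

instance DPred.inUnit (f : X → M.C .one) [hf : DFun M f] : DPred M (fun x => InUnit (f x)) := by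
  obtain ⟨t, ht⟩ := hf
  exact ⟨HOA.inUnit t, fun x => by simp [ht]⟩

theorem LeR.refl (x : M.C .one) : LeR x x := fun n =>
  le_add_of_nonneg_right (mul_nonneg zero_le_two (tw_pos n).le)

theorem EqR.refl (x : M.C .one) : EqR x x := ⟨.refl x, .refl x⟩

theorem isReal_constR (c : M.N) : IsReal (constR c) := fun n i => by
  simp [tw_pos]

/-! ## Functions and sequences -/

def IsFunNat (Y : M.C (.one ⇒ .nat)) : Prop :=
  ∀ x y, InUnit x → InUnit y → EqR x y → Y ⬝ x = Y ⬝ y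

def IsFunReal (a : M.C (.one ⇒ .one)) : Prop :=
  (∀ x, InUnit x → IsReal (a ⬝ x)) ∧ ∀ x y, InUnit x → InUnit y → EqR x y → EqR (a ⬝ x) (a ⬝ y)

def IsFin (w : M.C .seq) (n : M.N) : Prop :=
  (∀ i < n, IsReal (w ⬝ i)) ∧ ∀ i j, i < n → j < i → ¬ EqR (w ⬝ i) (w ⬝ j)

def PartialSums (a : M.C (.one ⇒ .one)) (w : M.C .seq) (n : M.N) (s : M.C .seq) : Prop :=
  s ⬝ (0 : M.N) = constR 0 ∧ ∀ i < n, ∀ k,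
    rat (s ⬝ (i + 1) ⬝ k) = rat (s ⬝ i ⬝ (k + 1)) + rat (a ⬝ (w ⬝ i) ⬝ (k + 1))

def AbsSumLt (a : M.C (.one ⇒ .one)) (w : M.C .seq) (n : M.N) (ε : M.C .one) : Prop :=
  ∃ s, PartialSums a w n s ∧ ∃ k, |rat (s ⬝ n ⬝ k)| + 2 * tw k < rat (ε ⬝ k)

def IsCauchy (a : M.C (.one ⇒ .one)) : Prop :=
  ∀ ε : M.C .one, IsReal ε → ¬ LeR ε (constR 0) → ∃ (w : M.C .seq) (n : M.N), IsFin w n ∧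
    ∀ (u : M.C .seq) (m : M.N), IsFin u m → (∀ i < m, InUnit (u ⬝ i)) →
      (∀ i j, i < m → j < n → ¬ EqR (u ⬝ i) (w ⬝ j)) → AbsSumLt a u m ε

@[simp] theorem sat_isFunNat (ρ : M.Val) (Y : Tm (.one ⇒ .nat)) :
    M.Sat ρ (isFunNat Y) ↔ IsFunNat (M.eval ρ Y : M.C (.one ⇒ .nat)) := by
  simp [isFunNat, IsFunNat]

@[simp] theorem sat_isFunReal (ρ : M.Val) (a : Tm (.one ⇒ .one)) :
    M.Sat ρ (isFunReal a) ↔ IsFunReal (M.eval ρ a : M.C (.one ⇒ .one)) := by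
  simp [isFunReal, IsFunReal]

@[simp] theorem sat_isFin (ρ : M.Val) (w : Tm .seq) (n : Tm .nat) :
    M.Sat ρ (isFin w n) ↔ IsFin (M.eval ρ w : M.C .seq) (M.eval ρ n) := by
  simp [isFin, IsFin]

@[simp] theorem sat_partialSums (ρ : M.Val) (a : Tm (.one ⇒ .one)) (w : Tm .seq) (n : Tm .nat)
    (s : Tm .seq) : M.Sat ρ (partialSums a w n s) ↔
      PartialSums (M.eval ρ a : M.C (.one ⇒ .one)) (M.eval ρ w) (M.eval ρ n) (M.eval ρ s) := by
  simp [partialSums, PartialSums, sat_eqAt, addR]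

@[simp] theorem sat_absLtR (ρ : M.Val) (x y : Tm .one) :
    M.Sat ρ (absLtR x y) ↔ ∃ k, |rat (M.eval ρ x ⬝ k : M.N)| + 2 * tw k <
      rat (M.eval ρ y ⬝ k : M.N) := by
  simp only [absLtR, PreModel.sat_exNat_succ, PreModel.sat_exNat_zero, PreModel.sat_and, sat_qAbs,
    PreModel.sat_neg, sat_qLe, eval_app, PreModel.eval_up, drop_succ_cons, drop_zero, eval_var,
    cons_zero, cons_succ, eval_add, eval_one, one_add_one_eq_two, map_ofNat, not_le]
  constructor
  · rintro ⟨k, u, hu, h⟩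
    exact ⟨k, by rwa [← hu.rat_eq]⟩
  · rintro ⟨k, h⟩
    obtain ⟨u, hu⟩ := exists_isAbs (M.eval ρ x ⬝ k : M.N)
    exact ⟨k, u, hu, by rwa [hu.rat_eq]⟩

@[simp] theorem sat_absSumLt (ρ : M.Val) (a : Tm (.one ⇒ .one)) (w : Tm .seq) (n : Tm .nat)
    (ε : Tm .one) : M.Sat ρ (absSumLt a w n ε) ↔
      AbsSumLt (M.eval ρ a : M.C (.one ⇒ .one)) (M.eval ρ w) (M.eval ρ n) (M.eval ρ ε) := by
  simp [absSumLt, AbsSumLt]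

@[simp] theorem sat_isCauchy (ρ : M.Val) (a : Tm (.one ⇒ .one)) :
    M.Sat ρ (isCauchy a) ↔ IsCauchy (M.eval ρ a : M.C (.one ⇒ .one)) := by
  simp [isCauchy, IsCauchy, finInUnit, finDisjoint, ltR]

theorem sat_SUM (ρ : M.Val) : M.Sat ρ SUM ↔
    ∀ a : M.C (.one ⇒ .one), IsFunReal a → (∀ x, InUnit x → LeR (constR 0) (a ⬝ x)) →
      IsCauchy a → ∃ y : M.C .seq, (∀ i : M.N, InUnit (y ⬝ i)) ∧
        ∀ x, InUnit x → (∀ i : M.N, ¬ EqR x (y ⬝ i)) → EqR (a ⬝ x) (constR 0) := by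
  simp [SUM]

theorem sat_NIN (ρ : M.Val) : M.Sat ρ NIN ↔
    ∀ Y : M.C (.one ⇒ .nat), IsFunNat Y →
      ¬ ∀ x y, InUnit x → InUnit y → Y ⬝ x = Y ⬝ y → EqR x y := by
  simp [NIN]

theorem exists_lam₃ {σ τ κ μ : Ty} (f : M.C σ → M.C τ → M.C κ → M.C μ)
    [hf : DFun M (fun x : ((Unit × M.C σ) × M.C τ) × M.C κ => f x.1.1.2 x.1.2 x.2)] :
    ∃ g : M.C (σ ⇒ τ ⇒ κ ⇒ μ), ∀ a b c, g ⬝ a ⬝ b ⬝ c = f a b c := by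
  obtain ⟨g, hg, h⟩ := hf.exists_lam
  obtain ⟨g', hg', h'⟩ := hg.exists_lam
  obtain ⟨g'', -, h''⟩ := hg'.exists_lam
  exact ⟨g'' (), fun a b c => by rw [h'', h', h]⟩

/-! ## Powers of two in the rationals -/

theorem tw_succ (n : M.N) : tw n = 2 * tw (n + 1) := by
  rw [tw, tw, pw_succ, map_add, ← two_mul, mul_inv, mul_inv_cancel_left₀ two_ne_zero]

theorem tw_add (m n : M.N) : tw (m + n) = tw m * tw n := by
  rw [tw, pw_add, map_mul, mul_inv, tw, tw]

theorem tw_zero : tw (0 : M.N) = 1 := by simp [tw]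

theorem tw_le_one (n : M.N) : tw n ≤ 1 := by
  refine inv_le_one_of_one_le₀ ?_
  rw [← map_one toQ, toQ_le]
  simpa using add_one_le_iff.2 (pw_pos n)

/-! ## Auxiliary objects -/

/-- An object that computes a code of `p / e` from `p` and `e`. -/
theorem exists_coder (M : ArithModel) : ∃ f : M.C (.nat ⇒ .nat ⇒ .nat),
    (∀ p e : M.N, 0 < e → rat (f ⬝ p ⬝ e) = toQ p / toQ e) ∧
      ∀ e : M.N, 0 < e → f ⬝ (0 : M.N) ⬝ e = (0 : M.N) := by
  -- With `e = d + 1`, the pairing equation is `2c = (2p + d)(2p + e) + 4p`; adding `2p + e` to both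
  -- sides removes `d` and keeps the relation quantifier-free. The case `p = 0` is fixed to the code
  -- `0`, since the initial partial sum must be the real `0` itself and not just an equal real.
  obtain ⟨f, hf⟩ := exists_choice₂ (M := M) (fun p e c => e = 0 ∨ p = 0 ∧ c = 0 ∨
    p ≠ 0 ∧ c + c + (p + p + e) = (p + p + e) * (p + p + e) + (p + p + (p + p))) (fun p e => by
      rcases eq_zero_or_succ e with rfl | ⟨d, rfl⟩
      · exact ⟨0, .inl rfl⟩
      by_cases hp : p = 0
      · exact ⟨0, .inr (.inl ⟨hp, rfl⟩)⟩
      obtain ⟨c, a, hc, ⟨rfl, -⟩ | ⟨-, h⟩⟩ := exists_code p d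
      · exact ⟨c, .inr (.inr ⟨hp, by rw [hc]; ring⟩)⟩
      · exact absurd h hp)
  refine ⟨f, fun p e he => ?_, fun e he => ?_⟩
  · rcases hf p e with h | ⟨rfl, h⟩ | ⟨-, h⟩
    · exact absurd h he.ne'
    · rw [h, rat_zero, map_zero, zero_div]
    · obtain rfl | ⟨d, rfl⟩ := eq_zero_or_succ e
      · exact absurd he (lt_irrefl _)
      have : IsFrac (f ⬝ p ⬝ (d + 1)) p 0 d := by
        refine ⟨p + p, add_right_cancel (b := p + p + (d + 1)) (h.trans ?_), .inl ⟨rfl, rfl⟩⟩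
        ring
      rw [this.rat_eq]
      simp
  · rcases hf 0 e with h | ⟨-, h⟩ | ⟨h, -⟩
    · exact absurd h he.ne'
    · exact h
    · exact absurd rfl h

/-- Definition by cases comes from choice: the relation is quantifier-free once values are taken at
`k`, and it determines `y`. -/
theorem exists_update (w : M.C .seq) (n : M.N) (x : M.C .one) :
    ∃ w' : M.C .seq, w' ⬝ n = x ∧ ∀ i, i ≠ n → w' ⬝ i = w ⬝ i := by
  obtain ⟨w', h⟩ := exists_choice₂ (M := M) (fun i k y =>
    i = n ∧ y = x ⬝ k ∨ i ≠ n ∧ y = w ⬝ i ⬝ k) (fun i k => by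
      by_cases hi : i = n
      · exact ⟨_, .inl ⟨hi, rfl⟩⟩
      · exact ⟨_, .inr ⟨hi, rfl⟩⟩)
  refine ⟨w', M.ext fun k => ?_, fun i hi => M.ext fun k => ?_⟩
  · rcases h n k with h | h
    · exact h.2
    · exact absurd rfl h.1
  · rcases h i k with h | h
    · exact absurd h.1 hi
    · exact h.2

instance DPred.isFin (f : X → M.C .seq) (g : X → M.N) [hf : DFun M f] [hg : DFun M g] :
    DPred M (fun x => IsFin (f x) (g x)) := by
  obtain ⟨t, ht⟩ := hf
  obtain ⟨u, hu⟩ := hg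
  exact ⟨HOA.isFin t u, fun x => by simp [ht, hu]⟩

theorem lt_add_one_cases {i n : M.N} (h : i < n + 1) : i < n ∨ i = n :=
  lt_add_one_iff.1 h

/-- If `Y` is injective, the finitely many reals with values below `k` form a finite sequence. -/
theorem exists_list {Y : M.C (.one ⇒ .nat)} (hY : IsFunNat Y)
    (hinj : ∀ x y, InUnit x → InUnit y → Y ⬝ x = Y ⬝ y → EqR x y) (k : M.N) :
    ∃ (w : M.C .seq) (n : M.N), IsFin w n ∧ (∀ i < n, InUnit (w ⬝ i) ∧ Y ⬝ (w ⬝ i) < k) ∧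
      ∀ x, InUnit x → Y ⬝ x < k → ∃ i < n, EqR x (w ⬝ i) := by
  refine induct (fun k : M.N => ∃ (w : M.C .seq) (n : M.N), IsFin w n ∧
    (∀ i, i < n → InUnit (w ⬝ i) ∧ Y ⬝ (w ⬝ i) < k) ∧
      ∀ x, InUnit x → Y ⬝ x < k → ∃ i, i < n ∧ EqR x (w ⬝ i)) ?_ (fun k ih => ?_) k
  · refine ⟨M.combK .one .nat ⬝ constR 0, 0, ⟨fun i hi => ?_, fun i j hi => ?_⟩, fun i hi => ?_,
      fun x _ hx => ?_⟩
    · exact absurd hi (not_lt_zero i)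
    · exact absurd hi (not_lt_zero i)
    · exact absurd hi (not_lt_zero i)
    · exact absurd hx (not_lt_zero _)
  obtain ⟨w, n, hfin, hw, hall⟩ := ih
  -- By injectivity at most one real has value `k`, so the sequence grows by at most one entry.
  by_cases hex : ∃ x, InUnit x ∧ Y ⬝ x = k
  · obtain ⟨x, hx, hxk⟩ := hex
    obtain ⟨w', hn, hne⟩ := exists_update w n x
    have hlt (i : M.N) (hi : i < n) : w' ⬝ i = w ⬝ i := hne i hi.ne
    refine ⟨w', n + 1, ⟨fun i hi => ?_, fun i j hi hj => ?_⟩, fun i hi => ?_, fun z hz hzk => ?_⟩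
    · rcases lt_add_one_cases hi with hi | rfl
      · rw [hlt i hi]
        exact hfin.1 i hi
      · rw [hn]
        exact hx.1
    · rcases lt_add_one_cases hi with hi | rfl
      · rw [hlt i hi, hlt j (hj.trans hi)]
        exact hfin.2 i j hi hj
      · rw [hn, hlt j hj]
        -- The new entry cannot repeat an old one: equal reals have equal values, but old values are
        -- below `k`.
        intro he
        have := hY _ _ hx (hw j hj).1 he
        rw [hxk] at this
        exact (hw j hj).2.ne this.symm
    · rcases lt_add_one_cases hi with hi | rfl
      · rw [hlt i hi]
        exact ⟨(hw i hi).1, (hw i hi).2.trans (lt_add_one_iff.2 le_rfl)⟩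
      · rw [hn, hxk]
        exact ⟨hx, lt_add_one_iff.2 le_rfl⟩
    · rcases lt_add_one_cases hzk with hzk | hzk
      · obtain ⟨i, hi, he⟩ := hall z hz hzk
        exact ⟨i, hi.trans (lt_add_one_iff.2 le_rfl), by rwa [hlt i hi]⟩
      · exact ⟨n, lt_add_one_iff.2 le_rfl, by rw [hn]; exact hinj z x hz hx (hzk.trans hxk.symm)⟩
  · refine ⟨w, n, hfin, fun i hi => ⟨(hw i hi).1, (hw i hi).2.trans (lt_add_one_iff.2 le_rfl)⟩,
      fun z hz hzk => ?_⟩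
    rcases lt_add_one_cases hzk with hzk | hzk
    · exact hall z hz hzk
    · exact absurd ⟨z, hz, hzk⟩ hex

/-! ## Sums of distinct powers of two -/

/-- As `m` may be nonstandard, the maximum is not that of an actually finite set and has to be
obtained by induction in the model. -/
theorem exists_bound (g : M.C .one) (m : M.N) : ∃ L, ∀ i < m, g ⬝ i < L := by
  refine induct (fun m : M.N => ∃ L : M.N, ∀ i, i < m → g ⬝ i < L) ?_ (fun m ih => ?_) m
  · exact ⟨0, fun i hi => absurd hi (not_lt_zero i)⟩
  · obtain ⟨L, hL⟩ := ih
    refine ⟨L + g ⬝ m + 1, fun i hi => lt_add_one_iff.2 ?_⟩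
    rcases lt_add_one_cases hi with hi | rfl
    · exact (hL i hi).le.trans le_self_add
    · exact le_add_self

/-- For distinct numbers `g i` with `k ≤ g i < L` there are numbers `S i` such that the partial
sums of `2^{-(g i + 1)}` are `S i / 2^L`, and they are bounded by `2^{-k}`. -/
theorem exists_sums (g : M.C .one) (m k L : M.N) (hk : ∀ i < m, k ≤ g ⬝ i) (hL : ∀ i < m, g ⬝ i < L)
    (hkL : k ≤ L) (hinj : ∀ i j, i < m → j < i → g ⬝ i ≠ g ⬝ j) :
    ∃ S : M.C .one, S ⬝ (0 : M.N) = (0 : M.N) ∧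
      (∀ i < m, toQ (S ⬝ (i + 1)) * tw L = toQ (S ⬝ i) * tw L + tw (g ⬝ i + 1)) ∧
      toQ (S ⬝ m) * tw L ≤ tw k := by
  -- `e K j` is `2^(L - g j - 1)` if `g j` lies below the threshold `K`, and `0` otherwise. The
  -- values `g j` come in no particular order, so the geometric bound is proved by raising `K`. The
  -- condition `g j < L` ensures that a value exists for every `j`.
  obtain ⟨e, he⟩ := exists_choice₂ (M := M) (fun K j y =>
    (g ⬝ j < K ∧ g ⬝ j < L) ∧ y * pw (g ⬝ j + 1) = pw L ∨ ¬ (g ⬝ j < K ∧ g ⬝ j < L) ∧ y = 0)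
    (fun K j => by
      by_cases h : g ⬝ j < K ∧ g ⬝ j < L
      · obtain ⟨c, hc⟩ := exists_add_eq (g ⬝ j + 1) L (add_one_le_iff.2 h.2)
        exact ⟨pw c, .inl ⟨h, by rw [hc, pw_add (_ + 1), mul_comm]⟩⟩
      · exact ⟨0, .inr ⟨h, rfl⟩⟩)
  have epos (K j : M.N) (h : g ⬝ j < K) (h' : g ⬝ j < L) : e ⬝ K ⬝ j * pw (g ⬝ j + 1) = pw L := by
    rcases he K j with h₁ | h₁
    · exact h₁.2
    · exact absurd ⟨h, h'⟩ h₁.1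
  have ezero (K j : M.N) (h : K ≤ g ⬝ j) : e ⬝ K ⬝ j = (0 : M.N) := by
    rcases he K j with h₁ | h₁
    · exact absurd h₁.1.1 h.not_gt
    · exact h₁.2
  obtain ⟨G, hG⟩ := exists_lam₃ (M := M) (fun K j acc : M.N => acc + e ⬝ K ⬝ j)
  -- `S K n` is the sum of `e K j` over `j < n`.
  obtain ⟨S, hS⟩ := exists_lam₂ (M := M)
    (fun K n : M.N => M.recursor .nat ⬝ (G ⬝ K) ⬝ (0 : M.N) ⬝ n)
  have S0 (K : M.N) : S ⬝ K ⬝ (0 : M.N) = (0 : M.N) := by rw [hS, ap_recursor_zero]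
  have Ssucc (K n : M.N) : S ⬝ K ⬝ (n + 1) = (S ⬝ K ⬝ n + e ⬝ K ⬝ n : M.N) := by
    rw [hS, ap_recursor_succ, hG, hS]
  have low (n : M.N) : n ≤ m → S ⬝ k ⬝ n = (0 : M.N) := by
    refine induct (fun n : M.N => n ≤ m → S ⬝ k ⬝ n = (0 : M.N)) (fun _ => S0 k)
      (fun n ih h => ?_) n
    have hn := add_one_le_iff.1 h
    rw [Ssucc, ih hn.le, ezero k n (hk n hn), add_zero]
  -- Passing from `K` to `K + 1` adds the single summand `2^(L - K - 1)` if `K` is a value of `g`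
  -- below `n`, and nothing otherwise. Recording which case holds lets injectivity exclude a second
  -- occurrence.
  have step (K n : M.N) : n ≤ m →
      (S ⬝ (K + 1) ⬝ n = S ⬝ K ⬝ n ∧ ∀ j, j < n → g ⬝ j ≠ K) ∨
      ((S ⬝ (K + 1) ⬝ n : M.N) * pw (K + 1) = S ⬝ K ⬝ n * pw (K + 1) + pw L ∧
        ∃ j, j < n ∧ g ⬝ j = K) := by
    refine induct (fun n : M.N => n ≤ m →
      (S ⬝ (K + 1) ⬝ n = S ⬝ K ⬝ n ∧ ∀ j, j < n → g ⬝ j ≠ K) ∨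
      ((S ⬝ (K + 1) ⬝ n : M.N) * pw (K + 1) = S ⬝ K ⬝ n * pw (K + 1) + pw L ∧
        ∃ j, j < n ∧ g ⬝ j = K)) (fun _ => ?_) (fun n ih h => ?_) n
    · exact .inl ⟨by rw [S0, S0], fun j hj => absurd hj (not_lt_zero j)⟩
    have hn := add_one_le_iff.1 h
    rw [Ssucc, Ssucc]
    by_cases hgn : g ⬝ n = K
    · rcases ih hn.le with ⟨h₁, h₂⟩ | ⟨-, j, hj, hgj⟩
      · refine .inr ⟨?_, n, lt_add_one_iff.2 le_rfl, hgn⟩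
        have h₃ := epos (K + 1) n (hgn ▸ lt_add_one_iff.2 le_rfl) (hL n hn)
        rw [hgn] at h₃
        rw [h₁, ezero K n hgn.ge, add_zero, add_mul, h₃]
      · exact absurd (hgn.trans hgj.symm) (hinj n j hn hj)
    · have hee : e ⬝ (K + 1) ⬝ n = e ⬝ K ⬝ n := by
        rcases lt_or_gt_of_ne hgn with hl | hl
        · have h₁ := epos K n hl (hL n hn)
          rw [← epos (K + 1) n (hl.trans (lt_add_one_iff.2 le_rfl)) (hL n hn)] at h₁
          exact (mul_right_cancel₀ (pw_pos _).ne' h₁).symm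
        · rw [ezero K n hl.le, ezero (K + 1) n (add_one_le_iff.2 hl)]
      rw [hee]
      rcases ih hn.le with ⟨h₁, h₂⟩ | ⟨h₁, j, hj, hgj⟩
      · refine .inl ⟨by rw [h₁], fun j hj => ?_⟩
        rcases lt_add_one_cases hj with hj | rfl
        · exact h₂ j hj
        · exact hgn
      · refine .inr ⟨?_, j, hj.trans (lt_add_one_iff.2 le_rfl), hgj⟩
        rw [add_mul, h₁, add_mul, add_right_comm]
  -- After division this is `S (k + c) m / 2^L ≤ 2^{-k} - 2^{-(k + c)}`, the geometric sum written
  -- without subtraction.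
  have bound (c : M.N) : (S ⬝ (k + c) ⬝ m : M.N) * pw (k + c) * pw k + pw L * pw k ≤
      pw L * pw (k + c) := by
    refine induct (fun c : M.N => (S ⬝ (k + c) ⬝ m : M.N) * pw (k + c) * pw k + pw L * pw k ≤
      pw L * pw (k + c)) ?_ (fun c ih => ?_) c
    · rw [add_zero, low m le_rfl]
      simp
    · have h₁ : (S ⬝ (k + c + 1) ⬝ m : M.N) * pw (k + c + 1) ≤
          S ⬝ (k + c) ⬝ m * pw (k + c + 1) + pw L := by
        rcases step (k + c) m le_rfl with ⟨h, -⟩ | ⟨h, -⟩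
        · rw [h]
          exact le_self_add
        · exact h.le
      rw [← add_assoc]
      calc (S ⬝ (k + c + 1) ⬝ m : M.N) * pw (k + c + 1) * pw k + pw L * pw k
          ≤ (S ⬝ (k + c) ⬝ m * pw (k + c + 1) + pw L) * pw k + pw L * pw k := by gcongr
        _ = ((S ⬝ (k + c) ⬝ m * pw (k + c)) * pw k + pw L * pw k) +
            ((S ⬝ (k + c) ⬝ m * pw (k + c)) * pw k + pw L * pw k) := by rw [pw_succ]; ring
        _ ≤ pw L * pw (k + c) + pw L * pw (k + c) := add_le_add ih ih
        _ = pw L * pw (k + c + 1) := by rw [pw_succ]; ring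
  refine ⟨S ⬝ L, S0 L, fun i hi => ?_, ?_⟩
  · have h := congrArg toQ (epos L i (hL i hi) (hL i hi))
    rw [map_mul] at h
    have h₁ := (toQ_pw_pos (g ⬝ i + 1)).ne'
    have h₂ := (toQ_pw_pos L).ne'
    rw [Ssucc, map_add, add_mul, add_right_inj, tw, tw, ← div_eq_mul_inv, div_eq_iff h₂, ← h,
      mul_comm (toQ _), inv_mul_cancel_left₀ h₁]
  · obtain ⟨c, rfl⟩ := exists_add_eq k L hkL
    have h := bound c
    have h₁ := toQ_le.2 (le_self_add.trans h)
    simp only [map_mul] at h₁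
    have h₂ := toQ_pw_pos (k + c)
    have h₃ := toQ_pw_pos k
    rw [tw, tw, ← div_eq_mul_inv, div_le_iff₀ h₂, inv_mul_eq_div, le_div_iff₀ h₃]
    refine le_of_mul_le_mul_left ?_ h₂
    linarith

/-! ## The family `2^{-(Y x + 1)}` -/

/-- Positivity of `ε` gives an index `n` with `ε_n - 2 · 2^{-n}` positive, hence at least `1 / k`
for some `k`. Outside the finite sequence of reals with `Y`-value below `k`, sums are at most
`2^{-k} < 1 / k`, and the same `n` witnesses the strict inequality of reals. -/
theorem isCauchy_of_rat_eq {Y : M.C (.one ⇒ .nat)} (hY : IsFunNat Y)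
    (hinj : ∀ x y, InUnit x → InUnit y → Y ⬝ x = Y ⬝ y → EqR x y) {a : M.C (.one ⇒ .one)}
    (ha : ∀ x k, rat (a ⬝ x ⬝ k) = tw (Y ⬝ x + 1)) : IsCauchy a := by
  intro ε _ hε
  obtain ⟨n, hn⟩ := not_forall.1 hε
  rw [ap_constR, rat_zero, zero_add, not_le] at hn
  obtain ⟨k, hk, hkε⟩ := exists_inv_le (sub_pos.2 hn)
  obtain ⟨w, N, hfin, -, hall⟩ := exists_list hY hinj k
  refine ⟨w, N, hfin, fun u m hu huI hdisj => ?_⟩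
  obtain ⟨g, hg⟩ := exists_lam (M := M) (fun i : M.N => Y ⬝ (u ⬝ i))
  obtain ⟨L, hL⟩ := exists_bound g m
  obtain ⟨f, hf, hf0⟩ := exists_coder M
  obtain ⟨S, S0, hS, hSk⟩ := exists_sums g m k (k + L)
    (fun i hi => by
      by_contra hlt
      obtain ⟨j, hj, he⟩ := hall _ (huI i hi) (by rw [← hg]; exact not_le.1 hlt)
      exact hdisj i j hi hj he)
    (fun i hi => (hL i hi).trans_le le_add_self) le_self_add
    (fun i j hi hj he => by
      rw [hg, hg] at he
      exact hu.2 i j hi hj (hinj _ _ (huI i hi) (huI j (hj.trans hi)) he))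
  -- All partial sums are exact rationals over the common denominator `2^(k + L)`, represented by
  -- constant sequences; the index shift in `addR` is therefore harmless.
  obtain ⟨s, hs⟩ := exists_lam₂ (M := M) (fun i _ : M.N => f ⬝ (S ⬝ i) ⬝ pw (k + L))
  have hrat (i l : M.N) : rat (s ⬝ i ⬝ l) = toQ (S ⬝ i) * tw (k + L) := by
    rw [hs, hf _ _ (pw_pos _), tw, div_eq_mul_inv]
  refine ⟨s, ⟨M.ext fun l => ?_, fun i hi l => ?_⟩, n, ?_⟩
  · rw [hs, S0, hf0 _ (pw_pos _), ap_constR]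
  · rw [hrat, hrat, ha, hS i hi, hg]
  · rw [hrat, abs_of_nonneg (mul_nonneg (toQ_nonneg _) (tw_pos _).le)]
    have h₁ : tw k < (toQ k)⁻¹ := inv_strictAnti₀ (toQ_pos.2 hk) (toQ_lt.2 (lt_pw k))
    linarith

/-! ## Diagonalization -/

/-- Comparing rational codes involves quantifiers over numerators and denominators, which blocks
quantifier-free choice. Here `s` is the diagonal `a + d` and `h` is half of `a`, rounded down; with
these functions as parameters the comparison becomes quantifier-free. -/
theorem exists_decoder (M : ArithModel) : ∃ s h : M.C .one, ∀ c : M.N,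
    (s ⬝ c * (s ⬝ c + 1) ≤ c + c ∧ (c + c : M.N) < (s ⬝ c + 1) * (s ⬝ c + 1 + 1)) ∧
    ((c + c : M.N) = s ⬝ c * (s ⬝ c + 1) + (h ⬝ c + h ⬝ c + (h ⬝ c + h ⬝ c)) ∨
      (c + c : M.N) = s ⬝ c * (s ⬝ c + 1) + (h ⬝ c + h ⬝ c + 1 + (h ⬝ c + h ⬝ c + 1))) := by
  obtain ⟨s, hs⟩ := exists_choice₁ (M := M)
    (fun c s => s * (s + 1) ≤ c + c ∧ c + c < (s + 1) * (s + 1 + 1)) (fun c => by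
      obtain ⟨a, d, h⟩ := exists_pair c
      refine ⟨a + d, h ▸ le_self_add, h ▸ ?_⟩
      exact mul_self_add_one_lt (lt_add_one_iff.2 le_rfl) a le_self_add)
  obtain ⟨h, hh⟩ := exists_choice₁ (M := M)
    (fun c h => c + c = s ⬝ c * (s ⬝ c + 1) + (h + h + (h + h)) ∨
      c + c = s ⬝ c * (s ⬝ c + 1) + (h + h + 1 + (h + h + 1))) (fun c => by
      obtain ⟨b, hb⟩ := exists_add_eq _ _ (hs c).1
      obtain ⟨t, ht⟩ := even_mul_succ (s ⬝ c : M.N)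
      obtain ⟨r, hr⟩ : ∃ r, b = r + r := by
        rcases even_or_odd b with h | ⟨r, rfl⟩
        · exact h
        · rw [ht] at hb
          exact absurd (by rw [hb]; ring) (add_self_ne (t + r) c)
      rcases even_or_odd r with ⟨h, rfl⟩ | ⟨h, rfl⟩
      · exact ⟨h, .inl (by rw [hb, hr])⟩
      · exact ⟨h, .inr (by rw [hb, hr])⟩)
  exact ⟨s, h, fun c => ⟨hs c, hh c⟩⟩

/-- The comparison of the rational with code `c` with a positive fraction `u / e`, in terms of the
decoding `s`, `h` of `c`. -/
def LeRat (c s h u e : M.N) : Prop :=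
  c + c = s * (s + 1) + (h + h + (h + h)) ∧ u * (s + 1) ≤ h * e + u * (h + h)

instance QPred.leRat {X : Type} [Ctx M X] (c s h u e : X → M.N) [DFun M c] [DFun M s] [DFun M h]
    [DFun M u] [DFun M e] : QPred M (fun x => LeRat (c x) (s x) (h x) (u x) (e x)) := by
  unfold LeRat
  infer_instance

/-- For even first component the code stands for `h / (d + 1)` with `s = 2h + d`, and adding `2hu`
to both sides of `u (d + 1) ≤ h e` eliminates `d`. For odd first component the rational is negative
and both sides fail. -/
theorem le_rat_iff {c s h u e : M.N} (hlt : c + c < (s + 1) * (s + 1 + 1))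
    (hc : c + c = s * (s + 1) + (h + h + (h + h)) ∨
      c + c = s * (s + 1) + (h + h + 1 + (h + h + 1))) (hu : 0 < u) (he : 0 < e) :
    toQ u / toQ e ≤ rat c ↔ LeRat c s h u e := by
  unfold LeRat
  have hle {a : M.N} (ha : c + c = s * (s + 1) + (a + a)) : a ≤ s := by
    rw [ha, show (s + 1) * (s + 1 + 1) = s * (s + 1) + (s + s + 1 + 1) by ring,
      add_lt_add_iff_left] at hlt
    by_contra hn
    have := add_one_le_iff.2 (not_le.1 hn)
    exact (add_le_add this this).not_gt
      (hlt.trans_eq (by ring))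
  have he' := toQ_pos.2 he
  have hu' := toQ_pos.2 hu
  rcases hc with hc | hc
  · obtain ⟨d, hd⟩ := exists_add_eq _ _ (hle hc)
    have hfrac : IsFrac c h 0 d := ⟨h + h, by rw [hc, hd], .inl ⟨rfl, rfl⟩⟩
    have hd' := toQ_add_one_pos d
    rw [hfrac.rat_eq, map_zero, sub_zero, div_le_div_iff₀ he' hd', and_iff_right hc, hd,
      show u * (h + h + d + 1) = u * (d + 1) + u * (h + h) by ring, add_le_add_iff_right, ← toQ_le]
    simp only [map_mul, map_add, map_one]
  · obtain ⟨d, hd⟩ := exists_add_eq _ _ (hle hc)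
    have hfrac : IsFrac c 0 (h + 1) d := ⟨h + h + 1, by rw [hc, hd], .inr ⟨by ring, rfl⟩⟩
    refine iff_of_false (fun hle => ?_) (fun hle => ?_)
    · have h₁ : 0 < toQ u / toQ e := div_pos hu' he'
      have h₂ : rat c ≤ 0 := by
        rw [hfrac.rat_eq, map_zero, zero_sub]
        exact div_nonpos_of_nonpos_of_nonneg (neg_nonpos.2 (toQ_nonneg _)) (toQ_add_one_pos d).le
      linarith
    · have := add_left_cancel (hc.symm.trans hle.1)
      exact add_self_ne h h (add_self_inj this)

/-- A sequence of numbers `P n`, such that the intervals `[P n / 4ⁿ, (P n + 1) / 4ⁿ]` are nested and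
avoid the reals `y n`. -/
theorem exists_digits (y : M.C .seq) : ∃ P : M.C .one, P ⬝ (0 : M.N) = (0 : M.N) ∧ ∀ n : M.N,
    (P ⬝ (n + 1) = (4 * P ⬝ n : M.N) ∧
      toQ (4 * P ⬝ n + 2 : M.N) * tw (n + n + 2) ≤ rat (y ⬝ n ⬝ (n + n + 4))) ∨
    (P ⬝ (n + 1) = (4 * P ⬝ n + 3 : M.N) ∧
      rat (y ⬝ n ⬝ (n + n + 4)) < toQ (4 * P ⬝ n + 2 : M.N) * tw (n + n + 2)) := by
  obtain ⟨s, h, hsh⟩ := exists_decoder M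
  obtain ⟨c, hc⟩ := exists_lam (M := M) (fun n : M.N => y ⬝ n ⬝ (n + n + 4))
  have key (n p : M.N) : LeRat (c ⬝ n) (s ⬝ (c ⬝ n)) (h ⬝ (c ⬝ n)) (4 * p + 2) (pw (n + n + 2)) ↔
      toQ (4 * p + 2) * tw (n + n + 2) ≤ rat (c ⬝ n) := by
    rw [← le_rat_iff (hsh (c ⬝ n)).1.2 (hsh (c ⬝ n)).2
      (add_pos_of_nonneg_of_pos (zero_le _) two_pos) (pw_pos _), div_eq_mul_inv, tw]
  -- The current interval is cut into quarters at level `n + 1`. The approximation of `y n` is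
  -- compared with the midpoint, and the outer quarter on the other side is kept, leaving a gap of
  -- at least one quarter.
  obtain ⟨F, hF⟩ := exists_choice₂ (M := M) (fun n p q =>
    LeRat (c ⬝ n) (s ⬝ (c ⬝ n)) (h ⬝ (c ⬝ n)) (4 * p + 2) (pw (n + n + 2)) ∧ q = 4 * p ∨
    ¬ LeRat (c ⬝ n) (s ⬝ (c ⬝ n)) (h ⬝ (c ⬝ n)) (4 * p + 2) (pw (n + n + 2)) ∧
      q = 4 * p + 3) (fun n p => by
    by_cases hb : toQ (4 * p + 2) * tw (n + n + 2) ≤ rat (c ⬝ n)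
    · exact ⟨_, .inl ⟨(key n p).2 hb, rfl⟩⟩
    · exact ⟨_, .inr ⟨fun h => hb ((key n p).1 h), rfl⟩⟩)
  obtain ⟨P, P0, hP⟩ := exists_rec F 0
  refine ⟨P, P0, fun n => ?_⟩
  have := hF n (P ⬝ n)
  rwa [key, ← hP, not_le, hc, and_comm, and_comm (a := _ < _)] at this

/-- Cantor's argument: the left endpoints `P k / 4^k` of the nested intervals form the real `x`.
Only the approximation of `y n` at index `2n + 4` matters, so the `y n` are not required to be
reals. -/
theorem exists_diagonal (y : M.C .seq) : ∃ x, InUnit x ∧ ∀ n : M.N, ¬ EqR x (y ⬝ n) := by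
  obtain ⟨P, P0, hP⟩ := exists_digits y
  obtain ⟨f, hf, -⟩ := exists_coder M
  obtain ⟨x, hx⟩ := exists_lam (M := M) (fun k : M.N => f ⬝ (P ⬝ k) ⬝ pw (k + k))
  have hrat (k : M.N) : rat (x ⬝ k) = toQ (P ⬝ k) * tw (k + k) := by
    rw [hx, hf _ _ (pw_pos _), tw, div_eq_mul_inv]
  have hpw (i : M.N) : pw (i + 1 + (i + 1)) = 4 * pw (i + i) := by
    rw [show i + 1 + (i + 1) = i + i + 1 + 1 by ring, pw_succ, pw_succ]
    ring
  -- Nestedness of the intervals at levels `k` and `k + i`, with denominators cleared.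
  have hmono (k i : M.N) : (P ⬝ k * pw (i + i) : M.N) ≤ P ⬝ (k + i) ∧
      (P ⬝ (k + i) + 1 : M.N) ≤ (P ⬝ k + 1) * pw (i + i) := by
    refine induct (fun i : M.N => (P ⬝ k * pw (i + i) : M.N) ≤ P ⬝ (k + i) ∧
      (P ⬝ (k + i) + 1 : M.N) ≤ (P ⬝ k + 1) * pw (i + i)) (by simp) (fun i ih => ?_) i
    rw [hpw, ← add_assoc]
    have h₁ : (4 * P ⬝ (k + i) : M.N) ≤ P ⬝ (k + i + 1) := by
      rcases hP (k + i) with ⟨h, -⟩ | ⟨h, -⟩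
      · exact h.ge
      · rw [h]
        exact le_self_add
    have h₂ : (P ⬝ (k + i + 1) + 1 : M.N) ≤ 4 * (P ⬝ (k + i) + 1) := by
      rcases hP (k + i) with ⟨h, -⟩ | ⟨h, -⟩
      · rw [h, show (4 * (P ⬝ (k + i) + 1) : M.N) = 4 * P ⬝ (k + i) + 1 + 3 by ring]
        exact le_self_add
      · rw [h]
        exact le_of_eq (by ring)
    constructor
    · calc (P ⬝ k * (4 * pw (i + i)) : M.N) = 4 * (P ⬝ k * pw (i + i)) := by ring
        _ ≤ 4 * P ⬝ (k + i) := by gcongr; exact ih.1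
        _ ≤ _ := h₁
    · calc (P ⬝ (k + i + 1) + 1 : M.N) ≤ 4 * (P ⬝ (k + i) + 1) := h₂
        _ ≤ 4 * ((P ⬝ k + 1) * pw (i + i)) := by gcongr; exact ih.2
        _ = _ := by ring
  have hbounds (k i : M.N) : rat (x ⬝ k) ≤ rat (x ⬝ (k + i)) ∧
      rat (x ⬝ (k + i)) < rat (x ⬝ k) + tw (k + k) := by
    have h₁ := toQ_le.2 (hmono k i).1
    have h₂ := toQ_le.2 (hmono k i).2
    simp only [map_add, map_mul, map_one] at h₁ h₂
    have hk := tw_pos (k + k)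
    have hi : toQ (pw (i + i)) * tw (i + i) = 1 := mul_inv_cancel₀ (toQ_pw_pos _).ne'
    have hi' := tw_pos (i + i)
    have hki := mul_pos hk hi'
    rw [hrat, hrat, show k + i + (k + i) = k + k + (i + i) by ring, tw_add (k + k)]
    constructor
    · calc toQ (P ⬝ k) * tw (k + k)
          = toQ (P ⬝ k) * toQ (pw (i + i)) * (tw (k + k) * tw (i + i)) := by
            linear_combination (-toQ (P ⬝ k) * tw (k + k)) * hi
        _ ≤ _ := by gcongr
    · calc toQ (P ⬝ (k + i)) * (tw (k + k) * tw (i + i))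
          < (toQ (P ⬝ (k + i)) + 1) * (tw (k + k) * tw (i + i)) := by gcongr; exact lt_add_one _
        _ ≤ (toQ (P ⬝ k) + 1) * toQ (pw (i + i)) * (tw (k + k) * tw (i + i)) := by gcongr
        _ = _ := by linear_combination ((toQ (P ⬝ k) + 1) * tw (k + k)) * hi
  have hx0 : rat (x ⬝ (0 : M.N)) = 0 := by rw [hrat, P0, map_zero, zero_mul]
  have htw (k : M.N) : tw (k + k) ≤ tw k := by
    rw [tw_add]
    exact mul_le_of_le_one_right (tw_pos k).le (tw_le_one k)
  refine ⟨x, ⟨fun n i => ⟨?_, ?_⟩, fun n => ?_, fun n => ?_⟩, fun n he => ?_⟩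
  · linarith [(hbounds n i).1, tw_pos n]
  · linarith [(hbounds n i).2, htw n]
  · have := (hbounds 0 n).1
    rw [zero_add, hx0] at this
    linarith [tw_pos n]
  · have := (hbounds 0 n).2
    rw [zero_add, hx0, add_zero, tw_zero] at this
    linarith [tw_pos n]
  -- At index `2n + 4` the gap is at least `4^{-(n + 1)} = 4 · 2^{-(2n + 4)}`, while equal reals
  -- differ there by at most `2 · 2^{-(2n + 4)}`.
  · have hm : n + 1 + (n + 3) = n + n + 4 := by ring
    have hb := hbounds (n + 1) (n + 3)
    rw [hm, hrat (n + 1), show n + 1 + (n + 1) = n + n + 2 by ring] at hb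
    have h₁ := he.1 (n + n + 4)
    have h₂ := he.2 (n + n + 4)
    have h₃ : tw (n + n + 2) = 4 * tw (n + n + 4) := by
      rw [tw_succ (n + n + 2), tw_succ (n + n + 2 + 1),
        show n + n + 2 + 1 + 1 = n + n + 4 by ring]
      ring
    have h₄ := tw_pos (n + n + 4)
    have t₂ : toQ (2 : M.N) = 2 := map_ofNat _ 2
    have t₃ : toQ (3 : M.N) = 3 := map_ofNat _ 3
    have t₄ : toQ (4 : M.N) = 4 := map_ofNat _ 4
    rcases hP n with ⟨h, hr⟩ | ⟨h, hr⟩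
    · rw [h] at hb
      simp only [map_add, map_mul, t₂, t₄, h₃, add_mul] at hb hr
      linarith [hb.2]
    · rw [h] at hb
      simp only [map_add, map_mul, t₂, t₃, t₄, h₃, add_mul] at hb hr
      linarith [hb.1]

/-! ## The theorem -/

theorem sat_SUM_imp_NIN (ρ : M.Val) : M.Sat ρ (SUM ⟹ NIN) := by
  rw [PreModel.sat_imp, sat_SUM, sat_NIN]
  intro hsum Y hY hinj
  obtain ⟨f, hf, -⟩ := exists_coder M
  -- The value at `x` is a constant sequence that depends only on `Y x`, so `a` respects equality of
  -- reals because `Y` does.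
  obtain ⟨a, ha⟩ := exists_lam₂ (M := M) (fun (x : M.C .one) (_ : M.N) =>
    f ⬝ (1 : M.N) ⬝ pw (Y ⬝ x + 1))
  have hrat (x : M.C .one) (k : M.N) : rat (a ⬝ x ⬝ k) = tw (Y ⬝ x + 1) := by
    rw [ha, hf _ _ (pw_pos _), map_one, one_div, tw]
  have hconst (x : M.C .one) : a ⬝ x = constR (f ⬝ (1 : M.N) ⬝ pw (Y ⬝ x + 1)) :=
    M.ext fun k => by rw [ha, ap_constR]
  obtain ⟨y, hy, hall⟩ := hsum a
    ⟨fun x _ => by rw [hconst]; exact isReal_constR _, fun x z hx hz he => by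
      rw [hconst, hconst, hY x z hx hz he]
      exact .refl _⟩
    (fun x _ n => by
      rw [ap_constR, rat_zero, hrat]
      linarith [tw_pos n, tw_pos (Y ⬝ x + 1)])
    (isCauchy_of_rat_eq hY hinj hrat)
  obtain ⟨x, hx, hne⟩ := exists_diagonal y
  -- At index `Y x + 3` the tolerance `2 · 2^{-(Y x + 3)}` is half of `a x`, so `a x` cannot equal
  -- `0`.
  have h := (hall x hx hne).1 (Y ⬝ x + 1 + 1 + 1)
  rw [hrat, ap_constR, rat_zero, tw_succ (Y ⬝ x + 1), tw_succ (Y ⬝ x + 1 + 1)] at h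
  linarith [tw_pos (Y ⬝ x + 1 + 1 + 1)]

end ArithModel

end HOA

theorem theorem3p5 : HOA.Proves (HOA.RCA0omega ∪ HOA.IND) (HOA.Fml.imp HOA.SUM HOA.NIN) :=
  HOA.proves_of_models (fun ρ τ => .inl (.ext ρ τ)) _ fun M hM =>
    HOA.ArithModel.sat_SUM_imp_NIN (M := ⟨M, fun h ρ => hM _ h ρ⟩) M.base
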